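/- Let $G=(V,E)$ be a connected simple undirected graph with $n\ge 2$ vertices and $m$ edges, each edge $e$ having a length $l(e)>0$, and let $1\le k\le n$. Regard each edge as a segment of its length. A point $x$ of $G$ lies on an edge $e(r,s)$ at some distance $t\in[0,l(e)]$ from $r$ along $e$, and $d(x,v)$ denotes the length of a shortest path between $x$ and the vertex $v$. Let $$\phi(x,G)=\min_{T^k}\ \max_{v\in V(T^k)} d(x,v),$$ where $T^k$ ranges over all subtrees with exactly $k$ vertices of $V$ of the shortest path trees of $x$ in $G$ (an interior point $x$ of an edge is not counted as a vertex). The unweighted connected $k$-vertex one-center problem asks for a point $x^*$ of $G$ minimizing $\phi(\cdot,G)$, together with $\lambda^*=\phi(x^*,G)$. For an edge $e(r,s)$, the chain of $v\in V$ is the graph of $t\mapsto d(x_t,v)$, $t\in[0,l(e)]$, where $x_t$ is the point of $e$ at distance $t$ from $r$. The general $k$-th level of the $n$ chains is the closure of the set of all points $(t,y)$ on the chains such that at least $k$ chains pass through or below $(t,y)$ and, among the points on the chains with abscissa $t$ having this property, the number of chains passing through or below is smallest. **Theorem.** There is an algorithm for the real RAM (unit-cost exact real arithmetic and comparisons, and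 integers bounded by a polynomial in $n$) which, given $n$, $m$, $k$, the list of edges with their endpoints and lengths, and the matrix of all distances $d(u,v)$, $u,v\in V$, computes in $O(mn\log n)$ time a point $x^*$ minimizing $\phi(\cdot,G)$ and the value $\lambda^*=\phi(x^*,G)$, and also, for every edge of $G$, a lowest point of the general $k$-th level of the $n$ chains of that edge. The constant in the $O$ is absolute. -/

import Mathlib

namespace OneCenter

/-! # Points, distances and shortest path trees of a graph with edge lengths -/

section Graph

variable {V : Type*}

/-- Length of a walk for the edge lengths `len`. -/
def walkLength {G : SimpleGraph V} (len : Sym2 V → ℝ) {u v : V} (p : G.Walk u v) : ℝ :=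
  (p.edges.map len).sum

/-- Length of a shortest path between two vertices (used for connected graphs only). -/
noncomputable def vdist (G : SimpleGraph V) (len : Sym2 V → ℝ) (u v : V) : ℝ :=
  ⨅ p : G.Path u v, walkLength len p.1

/-- The distance between the vertex `v` and the point of the edge `rs` that lies at distance `t`
from `r` along the edge: a path to that point enters the edge through `r` or through `s`. -/
noncomputable def chain (G : SimpleGraph V) (len : Sym2 V → ℝ) (r s v : V) (t : ℝ) : ℝ :=
  min (t + vdist G len r v) (len s(r, s) - t + vdist G len s v)

/-- A point `(r, s, t)` of the graph: it lies on the edge `rs`, at distance `t` from `r` along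
that edge. The endpoints of the edge are allowed. -/
structure Point (G : SimpleGraph V) (len : Sym2 V → ℝ) where
  r : V
  s : V
  adj : G.Adj r s
  t : ℝ
  t_nonneg : 0 ≤ t
  t_le : t ≤ len s(r, s)

/-- Distance between a point and a vertex. -/
noncomputable def Point.dist {G : SimpleGraph V} {len : Sym2 V → ℝ} (x : Point G len) (v : V) : ℝ :=
  chain G len x.r x.s v x.t

/-- `T` is a shortest path tree of the point `x` of `G`: a spanning tree of `G` in which, for every
vertex `v`, the path from `x` to `v` is a shortest path of `G`. Either `x` lies on the edge `rs` of
`T`, or `x` hangs at `r` by the segment from `x` to `r`, or it hangs at `s` by the segment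
from `x` to `s`. -/
def IsShortestPathTree {G : SimpleGraph V} {len : Sym2 V → ℝ} (x : Point G len)
    (T : SimpleGraph V) : Prop :=
  T ≤ G ∧ T.IsTree ∧
    ((T.Adj x.r x.s ∧ ∀ v, chain T len x.r x.s v x.t = x.dist v) ∨
      (∀ v, x.t + vdist T len x.r v = x.dist v) ∨
      (∀ v, len s(x.r, x.s) - x.t + vdist T len x.s v = x.dist v))

/-- `ρ` is the largest weighted distance from `x` to the vertices of some `k`-subtree (a subgraph
which is a tree with `k` vertices) of a shortest path tree of `x`. -/
def IsSubtreeRadius {G : SimpleGraph V} {len : Sym2 V → ℝ} (w : V → ℝ) (k : ℕ) (x : Point G len)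
    (ρ : ℝ) : Prop :=
  ∃ T : SimpleGraph V, IsShortestPathTree x T ∧
    ∃ H : T.Subgraph, H.coe.IsTree ∧ H.verts.ncard = k ∧
      IsGreatest ((fun v => w v * x.dist v) '' H.verts) ρ

/-- `ρ = φ(x, G)`: the minimum, over all `k`-subtrees of shortest path trees of `x`, of the largest
weighted distance from `x` to a vertex of the subtree. -/
def IsPhi {G : SimpleGraph V} {len : Sym2 V → ℝ} (w : V → ℝ) (k : ℕ) (x : Point G len)
    (ρ : ℝ) : Prop :=
  IsLeast {ρ | IsSubtreeRadius w k x ρ} ρ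

/-- `x` is a partial center, that is, a point minimizing `φ(·, G)`, and `ρ` is the minimum. -/
def IsPartialCenter {G : SimpleGraph V} {len : Sym2 V → ℝ} (w : V → ℝ) (k : ℕ) (x : Point G len)
    (ρ : ℝ) : Prop :=
  IsPhi w k x ρ ∧ ∀ y : Point G len, ∃ μ, IsPhi w k y μ ∧ ρ ≤ μ

/-- Number of distance chains of the edge `rs` that pass through or below the point `(t, y)`. -/
noncomputable def numBelow (G : SimpleGraph V) (len : Sym2 V → ℝ) (r s : V) (t y : ℝ) : ℕ :=
  {v : V | chain G len r s v t ≤ y}.ncard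

/-- The general `k`-th level of the distance chains `t ↦ chain G len r s v t`, `0 ≤ t ≤ len rs`,
of the edge `rs`: the closure of the set of all points `(t, y)` on the chains for which the vertical
ray going down from `(t, y)` meets at least `k` chains and, among the points on the chains with
abscissa `t` that have this property, meets the fewest. -/
def kLevel (G : SimpleGraph V) (len : Sym2 V → ℝ) (r s : V) (k : ℕ) : Set (ℝ × ℝ) :=
  closure {q | 0 ≤ q.1 ∧ q.1 ≤ len s(r, s) ∧ (∃ v, q.2 = chain G len r s v q.1) ∧
    k ≤ numBelow G len r s q.1 q.2 ∧
    ∀ v, k ≤ numBelow G len r s q.1 (chain G len r s v q.1) →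
      numBelow G len r s q.1 q.2 ≤ numBelow G len r s q.1 (chain G len r s v q.1)}

/-- `q` is a lowest point of the set `S` of the plane. -/
def IsLowestPoint (S : Set (ℝ × ℝ)) (q : ℝ × ℝ) : Prop :=
  q ∈ S ∧ ∀ p ∈ S, q.2 ≤ p.2

/-- `E` lists every edge of `G` exactly once, with its endpoints in some order. -/
def IsEdgeList {m : ℕ} (G : SimpleGraph V) (E : Fin m → V × V) : Prop :=
  Function.Injective (fun i => s((E i).1, (E i).2)) ∧
    Set.range (fun i => s((E i).1, (E i).2)) = G.edgeSet

end Graph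

/-! # A real random access machine

A machine has integer registers, real registers, integer arrays and real arrays, with
indirect addressing of the arrays. A program is a finite structured program. The elementary
operations are the arithmetic operations on integers and on exact reals, comparisons, reads, writes
and tests; each costs one. There is no operation that turns a real into an integer, and the
constants are natural numbers. The integers are machine words: a program may only store integers
that do not exceed a given bound. -/

/-- Memory of the machine. -/
structure Memory where
  ireg : ℕ → ℕ
  rreg : ℕ → ℝ
  iarr : ℕ → ℕ → ℕ
  rarr : ℕ → ℕ → ℝ

/-- Integer expressions; `sub` is truncated and `div` rounds down. -/
inductive IExp where
  | lit (c : ℕ)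
  | reg (i : ℕ)
  | arr (a : ℕ) (j : IExp)
  | add (e f : IExp)
  | sub (e f : IExp)
  | mul (e f : IExp)
  | div (e f : IExp)

/-- Real expressions. -/
inductive RExp where
  | lit (c : ℕ)
  | reg (i : ℕ)
  | arr (a : ℕ) (j : IExp)
  | add (e f : RExp)
  | sub (e f : RExp)
  | mul (e f : RExp)
  | div (e f : RExp)

/-- Tests. -/
inductive BExp where
  | ilt (e f : IExp)
  | rlt (e f : RExp)
  | neg (b : BExp)
  | conj (b c : BExp)

namespace IExp

/-- Value. -/
def eval (σ : Memory) : IExp → ℕ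
  | lit c => c
  | reg i => σ.ireg i
  | arr a j => σ.iarr a (j.eval σ)
  | add e f => e.eval σ + f.eval σ
  | sub e f => e.eval σ - f.eval σ
  | mul e f => e.eval σ * f.eval σ
  | div e f => e.eval σ / f.eval σ

/-- Number of elementary operations. -/
def cost : IExp → ℕ
  | lit _ => 1
  | reg _ => 1
  | arr _ j => 1 + j.cost
  | add e f => 1 + e.cost + f.cost
  | sub e f => 1 + e.cost + f.cost
  | mul e f => 1 + e.cost + f.cost
  | div e f => 1 + e.cost + f.cost

end IExp

namespace RExp

/-- Value. -/
noncomputable def eval (σ : Memory) : RExp → ℝ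
  | lit c => (c : ℝ)
  | reg i => σ.rreg i
  | arr a j => σ.rarr a (j.eval σ)
  | add e f => e.eval σ + f.eval σ
  | sub e f => e.eval σ - f.eval σ
  | mul e f => e.eval σ * f.eval σ
  | div e f => e.eval σ / f.eval σ

/-- Number of elementary operations. -/
def cost : RExp → ℕ
  | lit _ => 1
  | reg _ => 1
  | arr _ j => 1 + j.cost
  | add e f => 1 + e.cost + f.cost
  | sub e f => 1 + e.cost + f.cost
  | mul e f => 1 + e.cost + f.cost
  | div e f => 1 + e.cost + f.cost

end RExp

namespace BExp

/-- Truth of a test. -/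
def Holds (σ : Memory) : BExp → Prop
  | ilt e f => e.eval σ < f.eval σ
  | rlt e f => e.eval σ < f.eval σ
  | neg b => ¬ b.Holds σ
  | conj b c => b.Holds σ ∧ c.Holds σ

/-- Number of elementary operations. -/
def cost : BExp → ℕ
  | ilt e f => 1 + e.cost + f.cost
  | rlt e f => 1 + e.cost + f.cost
  | neg b => 1 + b.cost
  | conj b c => 1 + b.cost + c.cost

end BExp

/-- Programs. -/
inductive Program where
  | skip
  | iset (i : ℕ) (e : IExp)
  | rset (i : ℕ) (e : RExp)
  | iput (a : ℕ) (j e : IExp)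
  | rput (a : ℕ) (j : IExp) (e : RExp)
  | seq (p q : Program)
  | ite (b : BExp) (p q : Program)
  | loop (b : BExp) (p : Program)

namespace Memory

/-- Write to an integer register. -/
def setI (σ : Memory) (i c : ℕ) : Memory :=
  { σ with ireg := Function.update σ.ireg i c }

/-- Write to a real register. -/
noncomputable def setR (σ : Memory) (i : ℕ) (c : ℝ) : Memory :=
  { σ with rreg := Function.update σ.rreg i c }

/-- Write to an integer array. -/
def putI (σ : Memory) (a j c : ℕ) : Memory :=
  { σ with iarr := Function.update σ.iarr a (Function.update (σ.iarr a) j c) }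

/-- Write to a real array. -/
noncomputable def putR (σ : Memory) (a j : ℕ) (c : ℝ) : Memory :=
  { σ with rarr := Function.update σ.rarr a (Function.update (σ.rarr a) j c) }

end Memory

/-- `Exec W p σ τ σ'`: started in the memory `σ`, the program `p` halts after `τ` elementary steps
in the memory `σ'`, and never stores an integer above `W`. (`loop b p` repeats `p` while `b`
holds.) -/
inductive Exec (W : ℕ) : Program → Memory → ℕ → Memory → Prop
  | skip (σ : Memory) : Exec W .skip σ 1 σ
  | iset (σ : Memory) (i : ℕ) (e : IExp) (h : e.eval σ ≤ W) :
      Exec W (.iset i e) σ (1 + e.cost) (σ.setI i (e.eval σ))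
  | rset (σ : Memory) (i : ℕ) (e : RExp) :
      Exec W (.rset i e) σ (1 + e.cost) (σ.setR i (e.eval σ))
  | iput (σ : Memory) (a : ℕ) (j e : IExp) (hj : j.eval σ ≤ W) (h : e.eval σ ≤ W) :
      Exec W (.iput a j e) σ (1 + j.cost + e.cost) (σ.putI a (j.eval σ) (e.eval σ))
  | rput (σ : Memory) (a : ℕ) (j : IExp) (e : RExp) (hj : j.eval σ ≤ W) :
      Exec W (.rput a j e) σ (1 + j.cost + e.cost) (σ.putR a (j.eval σ) (e.eval σ))
  | seq {p q : Program} {σ σ₁ σ₂ : Memory} {τ₁ τ₂ : ℕ} (hp : Exec W p σ τ₁ σ₁)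
      (hq : Exec W q σ₁ τ₂ σ₂) : Exec W (.seq p q) σ (τ₁ + τ₂) σ₂
  | ite_true {b : BExp} {p q : Program} {σ σ₁ : Memory} {τ : ℕ} (hb : b.Holds σ)
      (hp : Exec W p σ τ σ₁) : Exec W (.ite b p q) σ (1 + b.cost + τ) σ₁
  | ite_false {b : BExp} {p q : Program} {σ σ₁ : Memory} {τ : ℕ} (hb : ¬ b.Holds σ)
      (hq : Exec W q σ τ σ₁) : Exec W (.ite b p q) σ (1 + b.cost + τ) σ₁
  | loop_false {b : BExp} {p : Program} {σ : Memory} (hb : ¬ b.Holds σ) :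
      Exec W (.loop b p) σ (1 + b.cost) σ
  | loop_true {b : BExp} {p : Program} {σ σ₁ σ₂ : Memory} {τ₁ τ₂ : ℕ} (hb : b.Holds σ)
      (hp : Exec W p σ τ₁ σ₁) (hl : Exec W (.loop b p) σ₁ τ₂ σ₂) :
      Exec W (.loop b p) σ (1 + b.cost + τ₁ + τ₂) σ₂

/-! # Input and output of the problem -/

/-- The memory that holds the input: the numbers `n`, `m`, `k` in integer registers `0`, `1`, `2`;
the endpoints of the `m` edges in integer arrays `0` and `1`; the edge lengths in real array `0`;
and the distance matrix, row by row, in real array `1`. Everything else is zero. -/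
noncomputable def inputMemory {n m : ℕ} (G : SimpleGraph (Fin n)) (len : Sym2 (Fin n) → ℝ)
    (E : Fin m → Fin n × Fin n) (k : ℕ) : Memory where
  ireg i := if i = 0 then n else if i = 1 then m else if i = 2 then k else 0
  rreg _ := 0
  iarr a i :=
    if h : i < m then
      if a = 0 then ((E ⟨i, h⟩).1 : ℕ) else if a = 1 then ((E ⟨i, h⟩).2 : ℕ) else 0
    else 0
  rarr a i :=
    if a = 0 then
      if h : i < m then len s((E ⟨i, h⟩).1, (E ⟨i, h⟩).2) else 0
    else if a = 1 then
      if h : i < n * n then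
        vdist G len ⟨i / n, Nat.div_lt_of_lt_mul h⟩
          ⟨i % n, Nat.mod_lt i (Nat.pos_of_ne_zero fun h0 => by simp [h0] at h)⟩
      else 0
    else 0

/-- The memory `σ` holds a solution of the unweighted problem (all vertex weights are one):
* for the edge number `i`, joining `r` and `s`, entry `i` of real array `2` and entry `i` of real
  array `3` are the coordinates of a lowest point of the general `k`-th level of the edge;
* integer register `3` is the number of an edge, and the point of this edge at distance
  `σ.rreg 0` from its first endpoint is a partial center, with objective value `σ.rreg 1`. -/
def HoldsSolution {n m : ℕ} (G : SimpleGraph (Fin n)) (len : Sym2 (Fin n) → ℝ)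
    (E : Fin m → Fin n × Fin n) (k : ℕ) (σ : Memory) : Prop :=
  (∀ i : Fin m, IsLowestPoint (kLevel G len (E i).1 (E i).2 k) (σ.rarr 2 i, σ.rarr 3 i)) ∧
    ∃ (i : Fin m) (x : Point G len), σ.ireg 3 = i ∧ x.r = (E i).1 ∧ x.s = (E i).2 ∧
      x.t = σ.rreg 0 ∧ IsPartialCenter (fun _ => 1) k x (σ.rreg 1)

end OneCenter

/-! For a fixed point `x`, the value φ(x) is simply the `k`-th smallest distance ρ from `x` to a
vertex (`isPhi_of_isLeast`). A subtree with `k` vertices cannot do better. Conversely, take all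
vertices strictly closer than ρ and fill up to `k` vertices with some at distance ρ. In a suitable
shortest path tree (`exists_shortestPathTree`) parents are strictly closer to `x`, so this set
contains the parents of its members and spans a subtree (`IsParent.isTree_induce`). The only
exception is an edge `rs` containing `x` that the tree uses: neither endpoint need be closer than
the other, but `s` may then serve as the top of the subtree.

Hence the center is a lowest point `(t, y)`, over all edges, with at least `k` chains `min (t + a v)
(l - t + b v)` at height at most `y`, where `a` and `b` are the distances from the two endpoints.
Such a point of an edge is also a lowest point of its `k`-th level (`isLowestPoint_kLevel`).

On one edge only `k + 1` candidates matter (`IsSortedList.le_of_feasible`). List the vertices as `A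
0, A 1, …` by increasing `a`. For a feasible `(t, y)`, the vertices whose rising part is at height
at most `y` form a prefix of some length `i`. If `i ≥ k`, the candidate above the first endpoint is
no higher. Otherwise let β be the value of rank `k - i` among the `b`-values of the rest. Both `a (A
(i - 1)) ≤ y - t` (for `i > 0`) and `β ≤ y - l + t` hold, and their sum no longer involves `t`: the
crossing height `(l + a (A (i - 1)) + β) / 2` is at most `y`. The case `i = 0`, and crossings that
would fall beyond the edge, reduce to the candidate above the second endpoint.

All β are found by letting `i` descend from `k` to `0`. Each step adds one vertex to the rest and
raises the rank by one, so one insertion into a priority queue and one extraction of a minimum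
suffice (`runs_nextRank`). With a tournament tree as queue, which also does the sorting, an edge
costs `O(n log n)`. The execution is verified by predicate transformers that carry the elapsed time,
and by a frame rule for untouched memory. -/

namespace OneCenter

/-! # Reasoning about programs -/

namespace Memory

variable (σ : Memory) (i j a c : ℕ) (x : ℝ)

@[simp] theorem setI_ireg : (σ.setI i c).ireg = Function.update σ.ireg i c := rfl
@[simp] theorem setI_rreg : (σ.setI i c).rreg = σ.rreg := rfl
@[simp] theorem setI_iarr : (σ.setI i c).iarr = σ.iarr := rfl
@[simp] theorem setI_rarr : (σ.setI i c).rarr = σ.rarr := rfl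
@[simp] theorem setR_ireg : (σ.setR i x).ireg = σ.ireg := rfl
@[simp] theorem setR_rreg : (σ.setR i x).rreg = Function.update σ.rreg i x := rfl
@[simp] theorem setR_iarr : (σ.setR i x).iarr = σ.iarr := rfl
@[simp] theorem setR_rarr : (σ.setR i x).rarr = σ.rarr := rfl
@[simp] theorem putI_ireg : (σ.putI a j c).ireg = σ.ireg := rfl
@[simp] theorem putI_rreg : (σ.putI a j c).rreg = σ.rreg := rfl
@[simp] theorem putI_iarr :
    (σ.putI a j c).iarr = Function.update σ.iarr a (Function.update (σ.iarr a) j c) := rfl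
@[simp] theorem putI_rarr : (σ.putI a j c).rarr = σ.rarr := rfl
@[simp] theorem putR_ireg : (σ.putR a j x).ireg = σ.ireg := rfl
@[simp] theorem putR_rreg : (σ.putR a j x).rreg = σ.rreg := rfl
@[simp] theorem putR_iarr : (σ.putR a j x).iarr = σ.iarr := rfl
@[simp] theorem putR_rarr :
    (σ.putR a j x).rarr = Function.update σ.rarr a (Function.update (σ.rarr a) j x) := rfl

end Memory

namespace Program

/-- Does the program assign to the integer register `x`? -/
def writesIReg (x : ℕ) : Program → Bool
  | iset i _ => i == x
  | seq p q => p.writesIReg x || q.writesIReg x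
  | ite _ p q => p.writesIReg x || q.writesIReg x
  | loop _ p => p.writesIReg x
  | _ => false

/-- Does the program assign to the real register `x`? -/
def writesRReg (x : ℕ) : Program → Bool
  | rset i _ => i == x
  | seq p q => p.writesRReg x || q.writesRReg x
  | ite _ p q => p.writesRReg x || q.writesRReg x
  | loop _ p => p.writesRReg x
  | _ => false

/-- Does the program write to the integer array `x`? -/
def writesIArr (x : ℕ) : Program → Bool
  | iput a _ _ => a == x
  | seq p q => p.writesIArr x || q.writesIArr x
  | ite _ p q => p.writesIArr x || q.writesIArr x
  | loop _ p => p.writesIArr x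
  | _ => false

/-- Does the program write to the real array `x`? -/
def writesRArr (x : ℕ) : Program → Bool
  | rput a _ _ => a == x
  | seq p q => p.writesRArr x || q.writesRArr x
  | ite _ p q => p.writesRArr x || q.writesRArr x
  | loop _ p => p.writesRArr x
  | _ => false

/-- The memories `σ` and `σ'` agree on everything that the program `p` does not write to. -/
structure Agree (p : Program) (σ σ' : Memory) : Prop where
  ireg : ∀ x, p.writesIReg x = false → σ'.ireg x = σ.ireg x
  rreg : ∀ x, p.writesRReg x = false → σ'.rreg x = σ.rreg x
  iarr : ∀ x, p.writesIArr x = false → σ'.iarr x = σ.iarr x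
  rarr : ∀ x, p.writesRArr x = false → σ'.rarr x = σ.rarr x

theorem Agree.refl (p : Program) (σ : Memory) : Agree p σ σ :=
  ⟨fun _ _ => rfl, fun _ _ => rfl, fun _ _ => rfl, fun _ _ => rfl⟩

theorem Agree.trans {p : Program} {σ₁ σ₂ σ₃ : Memory} (h : Agree p σ₁ σ₂) (h' : Agree p σ₂ σ₃) :
    Agree p σ₁ σ₃ :=
  ⟨fun x hx => (h'.ireg x hx).trans (h.ireg x hx), fun x hx => (h'.rreg x hx).trans (h.rreg x hx),
    fun x hx => (h'.iarr x hx).trans (h.iarr x hx), fun x hx => (h'.rarr x hx).trans (h.rarr x hx)⟩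

theorem Agree.mono {p q : Program} {σ σ' : Memory} (h : Agree p σ σ')
    (h₁ : ∀ x, q.writesIReg x = false → p.writesIReg x = false)
    (h₂ : ∀ x, q.writesRReg x = false → p.writesRReg x = false)
    (h₃ : ∀ x, q.writesIArr x = false → p.writesIArr x = false)
    (h₄ : ∀ x, q.writesRArr x = false → p.writesRArr x = false) : Agree q σ σ' :=
  ⟨fun x hx => h.ireg x (h₁ x hx), fun x hx => h.rreg x (h₂ x hx),
    fun x hx => h.iarr x (h₃ x hx), fun x hx => h.rarr x (h₄ x hx)⟩

end Program

open Program in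
-- Frame rule. The predicates `writesIReg`, `writesRReg`, `writesIArr`, `writesRArr` compute, so for
-- a concrete program the preservation of a register or array is discharged by `rfl`.
theorem Exec.agree {W : ℕ} {p : Program} {σ σ' : Memory} {τ : ℕ} (h : Exec W p σ τ σ') :
    Agree p σ σ' := by
  induction h with
  | skip σ => exact Agree.refl _ _
  | iset σ i e h =>
    refine ⟨fun x hx => ?_, fun _ _ => rfl, fun _ _ => rfl, fun _ _ => rfl⟩
    have : x ≠ i := by rintro rfl; simp [writesIReg] at hx
    simp [this]
  | rset σ i e =>
    refine ⟨fun _ _ => rfl, fun x hx => ?_, fun _ _ => rfl, fun _ _ => rfl⟩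
    have : x ≠ i := by rintro rfl; simp [writesRReg] at hx
    simp [this]
  | iput σ a j e hj h =>
    refine ⟨fun _ _ => rfl, fun _ _ => rfl, fun x hx => ?_, fun _ _ => rfl⟩
    have : x ≠ a := by rintro rfl; simp [writesIArr] at hx
    simp [this]
  | rput σ a j e hj =>
    refine ⟨fun _ _ => rfl, fun _ _ => rfl, fun _ _ => rfl, fun x hx => ?_⟩
    have : x ≠ a := by rintro rfl; simp [writesRArr] at hx
    simp [this]
  | seq hp hq ihp ihq =>
    refine Agree.trans (ihp.mono ?_ ?_ ?_ ?_) (ihq.mono ?_ ?_ ?_ ?_) <;> intro x hx <;>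
      simp_all [writesIReg, writesRReg, writesIArr, writesRArr]
  | ite_true hb hp ihp =>
    refine ihp.mono ?_ ?_ ?_ ?_ <;> intro x hx <;>
      simp_all [writesIReg, writesRReg, writesIArr, writesRArr]
  | ite_false hb hp ihp =>
    refine ihp.mono ?_ ?_ ?_ ?_ <;> intro x hx <;>
      simp_all [writesIReg, writesRReg, writesIArr, writesRArr]
  | loop_false hb => exact Agree.refl _ _
  | loop_true hb hp hl ihp ihl => exact Agree.trans ⟨ihp.1, ihp.2, ihp.3, ihp.4⟩ ihl

/-- The program `p`, started in `σ` at time `t`, halts at a time `t'` in a memory `σ'` such that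
`Q t' σ'`. -/
def WP (W : ℕ) (p : Program) (Q : ℕ → Memory → Prop) (t : ℕ) (σ : Memory) : Prop :=
  ∃ τ σ', Exec W p σ τ σ' ∧ Q (t + τ) σ'

/-- The program `p`, started in `σ`, halts after at most `B` steps in a memory `σ'` such
that `Q σ'`. -/
def Runs (W : ℕ) (p : Program) (σ : Memory) (B : ℕ) (Q : Memory → Prop) : Prop :=
  WP W p (fun t σ' => t ≤ B ∧ Q σ') 0 σ

/-! ### Predicate transformers that carry the elapsed time. -/

section WP

variable {W : ℕ} {Q : ℕ → Memory → Prop} {t : ℕ} {σ : Memory}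

theorem wp_iset {i : ℕ} {e : IExp} :
    WP W (.iset i e) Q t σ ↔ e.eval σ ≤ W ∧ Q (t + (1 + e.cost)) (σ.setI i (e.eval σ)) :=
  ⟨by rintro ⟨τ, σ', h, hQ⟩; cases h with | iset _ _ _ h => exact ⟨h, hQ⟩,
    fun h => ⟨_, _, .iset _ _ _ h.1, h.2⟩⟩

theorem wp_rset {i : ℕ} {e : RExp} :
    WP W (.rset i e) Q t σ ↔ Q (t + (1 + e.cost)) (σ.setR i (e.eval σ)) :=
  ⟨by rintro ⟨τ, σ', h, hQ⟩; cases h; exact hQ, fun h => ⟨_, _, .rset _ _ _, h⟩⟩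

theorem wp_iput {a : ℕ} {j e : IExp} :
    WP W (.iput a j e) Q t σ ↔ j.eval σ ≤ W ∧ e.eval σ ≤ W ∧
      Q (t + (1 + j.cost + e.cost)) (σ.putI a (j.eval σ) (e.eval σ)) :=
  ⟨by rintro ⟨τ, σ', h, hQ⟩; cases h with | iput _ _ _ _ hj h => exact ⟨hj, h, hQ⟩,
    fun h => ⟨_, _, .iput _ _ _ _ h.1 h.2.1, h.2.2⟩⟩

theorem wp_rput {a : ℕ} {j : IExp} {e : RExp} :
    WP W (.rput a j e) Q t σ ↔ j.eval σ ≤ W ∧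
      Q (t + (1 + j.cost + e.cost)) (σ.putR a (j.eval σ) (e.eval σ)) :=
  ⟨by rintro ⟨τ, σ', h, hQ⟩; cases h with | rput _ _ _ _ hj => exact ⟨hj, hQ⟩,
    fun h => ⟨_, _, .rput _ _ _ _ h.1, h.2⟩⟩

theorem wp_skip : WP W .skip Q t σ ↔ Q (t + 1) σ :=
  ⟨by rintro ⟨τ, σ', h, hQ⟩; cases h; exact hQ, fun h => ⟨_, _, .skip _, h⟩⟩

theorem wp_seq {p q : Program} : WP W (.seq p q) Q t σ ↔ WP W p (WP W q Q) t σ := by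
  constructor
  · rintro ⟨τ, σ', h, hQ⟩
    cases h with
    | seq hp hq => exact ⟨_, _, hp, _, _, hq, by rwa [add_assoc]⟩
  · rintro ⟨τ, σ', h, τ', σ'', h', hQ⟩
    exact ⟨_, _, .seq h h', by rwa [← add_assoc]⟩

theorem wp_ite {b : BExp} {p q : Program} :
    WP W (.ite b p q) Q t σ ↔ (b.Holds σ → WP W p Q (t + (1 + b.cost)) σ) ∧
      (¬ b.Holds σ → WP W q Q (t + (1 + b.cost)) σ) := by
  constructor
  · rintro ⟨τ, σ', h, hQ⟩
    cases h with
    | ite_true hb hp => exact ⟨fun _ => ⟨_, _, hp, by rwa [add_assoc]⟩, fun h => absurd hb h⟩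
    | ite_false hb hp => exact ⟨fun h => absurd h hb, fun _ => ⟨_, _, hp, by rwa [add_assoc]⟩⟩
  · rintro ⟨h, h'⟩
    by_cases hb : b.Holds σ
    · obtain ⟨τ, σ', hp, hQ⟩ := h hb
      exact ⟨_, _, .ite_true hb hp, by rwa [← add_assoc]⟩
    · obtain ⟨τ, σ', hp, hQ⟩ := h' hb
      exact ⟨_, _, .ite_false hb hp, by rwa [← add_assoc]⟩

/-- Use of the specification of a subprogram. -/
theorem Runs.wp {p : Program} {B : ℕ} {R : Memory → Prop} (h : Runs W p σ B R)
    (hQ : ∀ τ σ', τ ≤ B → p.Agree σ σ' → R σ' → Q (t + τ) σ') : WP W p Q t σ := by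
  obtain ⟨τ, σ', hp, hB, hR⟩ := h
  exact ⟨τ, σ', hp, hQ τ σ' (by omega) hp.agree hR⟩

theorem Runs.mono {p : Program} {B B' : ℕ} {R R' : Memory → Prop} (h : Runs W p σ B R)
    (hB : B ≤ B') (hR : ∀ σ', p.Agree σ σ' → R σ' → R' σ') : Runs W p σ B' R' :=
  h.wp fun τ σ' hτ ha h => ⟨by omega, hR σ' ha h⟩

/-- Loops: `I j σ` says that at most `j` iterations remain. -/
theorem Runs.loop {b : BExp} {p : Program} {B : ℕ} {R : Memory → Prop} (I : ℕ → Memory → Prop)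
    (σ₀ : Memory) (j : ℕ) (hI : I j σ₀)
    (h0 : ∀ j σ, p.Agree σ₀ σ → I j σ → ¬ b.Holds σ → R σ)
    (h1 : ∀ j σ, p.Agree σ₀ σ → I j σ → b.Holds σ → ∃ j', j = j' + 1 ∧ Runs W p σ B (I j')) :
    Runs W (.loop b p) σ₀ (j * (B + 1 + b.cost) + 1 + b.cost) R := by
  suffices H : ∀ j σ, p.Agree σ₀ σ → I j σ →
      Runs W (.loop b p) σ (j * (B + 1 + b.cost) + 1 + b.cost) R from
    H j σ₀ (Program.Agree.refl _ _) hI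
  intro j
  induction j with
  | zero =>
    intro σ ha hI
    by_cases hb : b.Holds σ
    · obtain ⟨j', h, -⟩ := h1 0 σ ha hI hb
      omega
    · exact ⟨_, _, .loop_false hb, by omega, h0 0 σ ha hI hb⟩
  | succ j ih =>
    intro σ ha hI
    by_cases hb : b.Holds σ
    · obtain ⟨j', h, τ, σ', hp, hτ, hI'⟩ := h1 _ σ ha hI hb
      obtain rfl : j = j' := by omega
      obtain ⟨τ', σ'', hl, hτ', hR⟩ := ih σ' (ha.trans hp.agree) hI'
      refine ⟨_, _, .loop_true hb hp hl, ?_, hR⟩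
      rw [Nat.succ_mul]
      omega
    · exact ⟨_, _, .loop_false hb, by rw [Nat.succ_mul]; omega, h0 _ σ ha hI hb⟩

/-- The last, failing test is charged as one more full round, which gives a product as bound. -/
theorem Runs.loop_le {b : BExp} {p : Program} {B D : ℕ} {R : Memory → Prop}
    (I : ℕ → Memory → Prop) (σ₀ : Memory) (j : ℕ) (hI : I j σ₀)
    (h0 : ∀ j σ, p.Agree σ₀ σ → I j σ → ¬ b.Holds σ → R σ)
    (h1 : ∀ j σ, p.Agree σ₀ σ → I j σ → b.Holds σ → ∃ j', j = j' + 1 ∧ Runs W p σ B (I j'))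
    (hD : B + 1 + b.cost ≤ D) : Runs W (.loop b p) σ₀ ((j + 1) * D) R := by
  refine (Runs.loop I σ₀ j hI h0 h1).mono ?_ fun _ _ h => h
  have := Nat.mul_le_mul_left j hD
  rw [Nat.succ_mul]
  omega

end WP

/-! # A priority queue of vertices: a tournament tree -/

/-- The entry `x` of a tournament tree wins against `y`. The entry `0` is void and `v + 1` stands
for the vertex `v`. -/
def Beats (key : ℕ → ℝ) (x y : ℕ) : Prop :=
  y = 0 ∨ 0 < x ∧ key (x - 1) ≤ key (y - 1)

theorem Beats.refl (key : ℕ → ℝ) (x : ℕ) : Beats key x x := by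
  rcases Nat.eq_zero_or_pos x with h | h
  · exact .inl h
  · exact .inr ⟨h, le_rfl⟩

theorem Beats.trans {key : ℕ → ℝ} {x y z : ℕ} (h : Beats key x y) (h' : Beats key y z) :
    Beats key x z := by
  rcases h' with h' | ⟨h1, h2⟩
  · exact .inl h'
  · rcases h with h | ⟨h3, h4⟩
    · omega
    · exact .inr ⟨h3, h4.trans h2⟩

/-- The node `i` of the tournament tree holds the winner of its two children. -/
def HoldsWinner (key : ℕ → ℝ) (tree : ℕ → ℕ) (i : ℕ) : Prop :=
  tree i = tree (2 * i) ∧ Beats key (tree (2 * i)) (tree (2 * i + 1)) ∨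
    tree i = tree (2 * i + 1) ∧ Beats key (tree (2 * i + 1)) (tree (2 * i))

/-- `tree` is a tournament tree for the set `Q` of vertices, except that the nodes from `j` up to
the root may be wrong. -/
structure IsQueueExcept (n : ℕ) (key : ℕ → ℝ) (tree : ℕ → ℕ) (Q : Finset ℕ) (j : ℕ) : Prop where
  leaf : ∀ v < n, tree (n + v) = if v ∈ Q then v + 1 else 0
  inner : ∀ i, 1 ≤ i → i < n → (∀ e, i ≠ j / 2 ^ e) → HoldsWinner key tree i

/-- `tree` is a tournament tree for the set `Q` of vertices. -/
abbrev IsQueue (n : ℕ) (key : ℕ → ℝ) (tree : ℕ → ℕ) (Q : Finset ℕ) : Prop :=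
  IsQueueExcept n key tree Q 0

/-- The exempt path that starts at node `0` consists of node `0` alone, and inner nodes are numbered
from `1`. -/
theorem IsQueue.holdsWinner {n : ℕ} {key : ℕ → ℝ} {tree : ℕ → ℕ} {Q : Finset ℕ}
    (h : IsQueue n key tree Q) {i : ℕ} (h1 : 1 ≤ i) (h2 : i < n) : HoldsWinner key tree i :=
  h.inner i h1 h2 fun e => by rw [Nat.zero_div]; omega

theorem isQueue_empty {n : ℕ} (key : ℕ → ℝ) {tree : ℕ → ℕ} (h : ∀ i < 2 * n, tree i = 0) :
    IsQueue n key tree ∅ :=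
  ⟨fun v hv => by simpa using h (n + v) (by omega),
    fun i h1 h2 _ => .inl ⟨by rw [h i (by omega), h (2 * i) (by omega)],
      .inl (h _ (by omega))⟩⟩

/-- Going from parent to child, the root beats every node; following winners downwards, its entry
comes from a leaf. The inner nodes are `1, …, n - 1` and the leaves `n, …, 2 * n - 1`, so `n` need
not be a power of two. -/
theorem IsQueue.root {n : ℕ} {key : ℕ → ℝ} {tree : ℕ → ℕ} {Q : Finset ℕ}
    (h : IsQueue n key tree Q) (hQ : Q ⊆ Finset.range n) (hne : Q.Nonempty) :
    ∃ v ∈ Q, tree 1 = v + 1 ∧ ∀ u ∈ Q, key v ≤ key u := by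
  have hbeats : ∀ j, 1 ≤ j → j < 2 * n → Beats key (tree 1) (tree j) := by
    intro j
    induction j using Nat.strong_induction_on with
    | _ j ih =>
      intro h1 h2
      rcases Nat.lt_or_ge 1 j with hj | hj
      · refine (ih (j / 2) (by omega) (by omega) (by omega)).trans ?_
        have hw := h.holdsWinner (i := j / 2) (by omega) (by omega)
        rcases Nat.even_or_odd' j with ⟨c, rfl | rfl⟩
        · rw [Nat.mul_div_cancel_left c two_pos] at hw ⊢
          rcases hw with ⟨e, hb⟩ | ⟨e, hb⟩
          · rw [e]; exact Beats.refl _ _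
          · rw [e]; exact hb
        · rw [show (2 * c + 1) / 2 = c by omega] at hw ⊢
          rcases hw with ⟨e, hb⟩ | ⟨e, hb⟩
          · rw [e]; exact hb
          · rw [e]; exact Beats.refl _ _
      · obtain rfl : j = 1 := by omega
        exact Beats.refl _ _
  have hmem : ∀ d j, 2 * n - j ≤ d → 1 ≤ j → j < 2 * n →
      tree j = 0 ∨ ∃ v ∈ Q, tree j = v + 1 := by
    intro d
    induction d with
    | zero => intro j h0 h1 h2; omega
    | succ d ih =>
      intro j h0 h1 h2
      rcases Nat.lt_or_ge j n with hj | hj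
      · rcases h.holdsWinner h1 hj with ⟨e, -⟩ | ⟨e, -⟩
        · rw [e]; exact ih _ (by omega) (by omega) (by omega)
        · rw [e]; exact ih _ (by omega) (by omega) (by omega)
      · have := h.leaf (j - n) (by omega)
        rw [Nat.add_sub_cancel' hj] at this
        split_ifs at this with hv
        · exact .inr ⟨_, hv, this⟩
        · exact .inl this
  have hkey : ∀ u ∈ Q, 0 < tree 1 ∧ key (tree 1 - 1) ≤ key u := by
    intro u hu
    have hun := Finset.mem_range.1 (hQ hu)
    have := hbeats (n + u) (by omega) (by omega)
    rw [h.leaf u hun, if_pos hu] at this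
    simpa [Beats] using this
  obtain ⟨u, hu⟩ := hne
  have hun := Finset.mem_range.1 (hQ hu)
  rcases hmem (2 * n) 1 (by omega) le_rfl (by omega) with h0 | ⟨v, hv, e⟩
  · exact absurd (hkey u hu).1 (by omega)
  · refine ⟨v, hv, e, fun u hu => ?_⟩
    simpa [e] using (hkey u hu).2

/-- A node is read only by its parent, so a new entry at the leaf `n + v` can spoil only the match
at `(n + v) / 2`. -/
theorem IsQueue.set_leaf {n : ℕ} {key : ℕ → ℝ} {tree : ℕ → ℕ} {Q Q' : Finset ℕ}
    (h : IsQueue n key tree Q) {v x : ℕ} (hv : v < n) (hQ : ∀ u ≠ v, u ∈ Q' ↔ u ∈ Q)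
    (hx : x = if v ∈ Q' then v + 1 else 0) :
    IsQueueExcept n key (Function.update tree (n + v) x) Q' ((n + v) / 2) where
  leaf u hu := by
    by_cases huv : u = v
    · subst huv; simpa using hx
    · rw [Function.update_of_ne (by omega), h.leaf u hu, if_congr (hQ u huv).symm rfl rfl]
  inner i h1 h2 h3 := by
    have h4 : i ≠ (n + v) / 2 := by simpa using h3 0
    have := h.holdsWinner h1 h2
    unfold HoldsWinner at this ⊢
    rwa [Function.update_of_ne (by omega), Function.update_of_ne (by omega),
      Function.update_of_ne (by omega)]

/-- Replaying the match at `j` repairs `j` and may spoil only its parent: the exempt path loses its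
lowest node. -/
theorem IsQueueExcept.set_inner {n : ℕ} {key : ℕ → ℝ} {tree : ℕ → ℕ} {Q : Finset ℕ} {j : ℕ}
    (h : IsQueueExcept n key tree Q j) (h1 : 1 ≤ j) (h2 : j < n) {x : ℕ}
    (hx : x = tree (2 * j) ∧ Beats key (tree (2 * j)) (tree (2 * j + 1)) ∨
      x = tree (2 * j + 1) ∧ Beats key (tree (2 * j + 1)) (tree (2 * j))) :
    IsQueueExcept n key (Function.update tree j x) Q (j / 2) where
  leaf u hu := by rw [Function.update_of_ne (by omega), h.leaf u hu]
  inner i h3 h4 h5 := by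
    have h6 : i ≠ j / 2 := by simpa using h5 0
    by_cases hij : i = j
    · subst hij
      unfold HoldsWinner
      rwa [Function.update_self, Function.update_of_ne (by omega),
        Function.update_of_ne (by omega)]
    · have := h.inner i h3 h4 fun e => by
        cases e with
        | zero => simpa using hij
        | succ e => rw [pow_succ', ← Nat.div_div_eq_div_mul]; exact h5 e
      unfold HoldsWinner at this ⊢
      rwa [Function.update_of_ne hij, Function.update_of_ne (by omega),
        Function.update_of_ne (by omega)]

/-! ## Programs

Integer registers: `0`, `1`, `2` hold `n`, `m`, `k`; `3` the edge of the best point so far; `4` the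
current edge, `5` and `6` its endpoints; `7` the row of the distance matrix that gives the keys of
the queue; `8` a counter; `9` a node of the tree; `10` and `11` the arguments of `update`.
Integer array `2` is the tree, integer array `3` a sorted list of the vertices.
Real registers: `0` and `1` hold the best point so far; `2` the length of the current edge; `3` the
current rank; `4` a scratch value; `5` and `6` the best point of the current edge.
Real array `4` holds the keys. -/

/-- Fill the keys from row `ireg 7` of the distance matrix and empty the queue. -/
def initQueue : Program :=
  .seq (.iset 8 (.lit 0)) <|
  .loop (.ilt (.reg 8) (.reg 0)) <|
    .seq (.rput 4 (.reg 8) (.arr 1 (.add (.mul (.reg 7) (.reg 0)) (.reg 8)))) <|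
    .seq (.iput 2 (.reg 8) (.lit 0)) <|
    .seq (.iput 2 (.add (.reg 0) (.reg 8)) (.lit 0)) <|
    .iset 8 (.add (.reg 8) (.lit 1))

/-- The entry of the left child of the current node. -/
def leftEntry : IExp := .arr 2 (.mul (.lit 2) (.reg 9))

/-- The entry of the right child of the current node. -/
def rightEntry : IExp := .arr 2 (.add (.mul (.lit 2) (.reg 9)) (.lit 1))

/-- Let the children of the current node play. -/
def playNode : Program :=
  .ite (.conj (.ilt (.lit 0) leftEntry)
      (.neg (.conj (.ilt (.lit 0) rightEntry)
        (.rlt (.arr 4 (.sub rightEntry (.lit 1))) (.arr 4 (.sub leftEntry (.lit 1)))))))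
    (.iput 2 (.reg 9) leftEntry) (.iput 2 (.reg 9) rightEntry)

/-- Set the leaf of the vertex `ireg 10` to `ireg 11` and repair the tree. -/
def updateQueue : Program :=
  .seq (.iset 9 (.add (.reg 0) (.reg 10))) <|
  .seq (.iput 2 (.reg 9) (.reg 11)) <|
  .seq (.iset 9 (.div (.reg 9) (.lit 2))) <|
  .loop (.ilt (.lit 0) (.reg 9)) (.seq playNode (.iset 9 (.div (.reg 9) (.lit 2))))

/-- Insert the vertex `ireg 10`. -/
def insertQueue : Program :=
  .seq (.iset 11 (.add (.reg 10) (.lit 1))) updateQueue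

/-- Extract a vertex with least key into `ireg 10`. -/
def popQueue : Program :=
  .seq (.iset 10 (.sub (.arr 2 (.lit 1)) (.lit 1))) (.seq (.iset 11 (.lit 0)) updateQueue)

/-! ### Correctness and cost of the queue operations. -/

section Specs

variable {W n : ℕ} {σ : Memory}

theorem runs_playNode (hW : 2 * n ≤ W) {j : ℕ} (hj : σ.ireg 9 = j) (h1 : 1 ≤ j) (h2 : j < n)
    (hent : ∀ i, σ.iarr 2 i ≤ n) {Q : Finset ℕ}
    (h : IsQueueExcept n (σ.rarr 4) (σ.iarr 2) Q j) :
    Runs W playNode σ 100 fun σ' => (∀ i, σ'.iarr 2 i ≤ n) ∧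
      IsQueueExcept n (σ.rarr 4) (σ'.iarr 2) Q (j / 2) := by
  have key : ∀ x, (∃ i, x = σ.iarr 2 i) →
      (∀ i, Function.update (σ.iarr 2) j x i ≤ n) := by
    rintro _ ⟨i, rfl⟩ i'
    rw [Function.update_apply]
    split_ifs <;> exact hent _
  simp only [Runs, playNode, leftEntry, rightEntry, wp_ite, wp_iput, BExp.Holds, IExp.eval,
    RExp.eval, hj, BExp.cost, IExp.cost, RExp.cost, Memory.putI_iarr, Function.update_self]
  refine ⟨fun hb => ⟨by omega, (hent _).trans (by omega), by norm_num, key _ ⟨_, rfl⟩,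
    h.set_inner h1 h2 (.inl ⟨rfl, ?_⟩)⟩, fun hb => ⟨by omega, (hent _).trans (by omega),
    by norm_num, key _ ⟨_, rfl⟩, h.set_inner h1 h2 (.inr ⟨rfl, ?_⟩)⟩⟩
  · obtain ⟨hb1, hb2⟩ := hb
    rcases Nat.eq_zero_or_pos (σ.iarr 2 (2 * j + 1)) with h0 | h0
    · exact .inl h0
    · exact .inr ⟨hb1, not_lt.1 fun hlt => hb2 ⟨h0, hlt⟩⟩
  · rcases Nat.eq_zero_or_pos (σ.iarr 2 (2 * j)) with h0 | h0
    · exact .inl h0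
    · by_contra hn
      refine hb ⟨h0, fun hc => hn (.inr ⟨hc.1, hc.2.le⟩)⟩

/-- The queue of the machine holds the vertices of `Q`. -/
structure QueueState (n : ℕ) (σ : Memory) (key : ℕ → ℝ) (Q : Finset ℕ) : Prop where
  size : σ.ireg 0 = n
  key_eq : ∀ v < n, σ.rarr 4 v = key v
  entry_le : ∀ i, σ.iarr 2 i ≤ n
  isQueue : IsQueue n (σ.rarr 4) (σ.iarr 2) Q
  subset : Q ⊆ Finset.range n

theorem QueueState.congr {σ σ' : Memory} {key : ℕ → ℝ} {Q : Finset ℕ} (h : QueueState n σ key Q)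
    (h0 : σ'.ireg 0 = σ.ireg 0) (h2 : σ'.iarr 2 = σ.iarr 2) (h4 : σ'.rarr 4 = σ.rarr 4) :
    QueueState n σ' key Q :=
  ⟨h0 ▸ h.size, h4 ▸ h.key_eq, h2 ▸ h.entry_le, h2 ▸ h4 ▸ h.isQueue, h.subset⟩

theorem runs_updateQueue (hW : 2 * n ≤ W) {key : ℕ → ℝ} {Q Q' : Finset ℕ}
    (h : QueueState n σ key Q) (hv : σ.ireg 10 < n)
    (hQ : ∀ u ≠ σ.ireg 10, u ∈ Q' ↔ u ∈ Q)
    (hx : σ.ireg 11 = if σ.ireg 10 ∈ Q' then σ.ireg 10 + 1 else 0) :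
    Runs W updateQueue σ (110 * (Nat.log 2 n + 2)) fun σ' => QueueState n σ' key Q' := by
  have hsub : Q' ⊆ Finset.range n := by
    intro u hu
    by_cases huv : u = σ.ireg 10
    · subst huv; exact Finset.mem_range.2 hv
    · exact h.subset ((hQ u huv).1 hu)
  have hxle : σ.ireg 11 ≤ n := by rw [hx]; split_ifs <;> omega
  have hsize := h.size
  simp only [Runs, updateQueue, wp_seq, wp_iset, wp_iput, IExp.eval, IExp.cost,
    Memory.setI_ireg, Memory.putI_ireg, Function.update_self, hsize]
  norm_num
  refine ⟨by omega, by omega, by omega, ?_⟩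
  -- The current node is below `2 ^ p` with `p` rounds left and is halved in each round; it starts
  -- below `n`, hence below `2 ^ (Nat.log 2 n + 1)`. A round costs at most 100 for the match and 4
  -- for the halving.
  refine Runs.wp (Runs.loop (B := 110 - 5) (R := fun σ' => QueueState n σ' key Q')
    (fun p σ' => σ'.ireg 9 < 2 ^ p ∧ σ'.ireg 9 < n ∧ (∀ i, σ'.iarr 2 i ≤ n) ∧
      IsQueueExcept n (σ.rarr 4) (σ'.iarr 2) Q' (σ'.ireg 9)) _ (Nat.log 2 n + 1) ?_ ?_ ?_) ?_
  · simp only [Memory.setI_ireg, Memory.putI_ireg, Function.update_self, Memory.setI_iarr,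
      Memory.putI_iarr]
    refine ⟨?_, by omega, ?_, ?_⟩
    · have := Nat.lt_pow_succ_log_self (b := 2) one_lt_two n
      omega
    · intro i
      rw [Function.update_apply]
      split_ifs
      · exact hxle
      · exact h.entry_le i
    · exact h.isQueue.set_leaf hv hQ hx
  · intro p σ' ha ⟨h1, h2, h3, h4⟩ hb
    have e0 := ha.ireg 0 rfl
    have e4 := ha.rarr 4 rfl
    simp at e0 e4
    have e9 : σ'.ireg 9 = 0 := by simpa [BExp.Holds, IExp.eval] using hb
    rw [e9] at h4
    exact ⟨by rw [e0, hsize], by rw [e4]; exact h.key_eq, h3, by rw [e4]; exact h4, hsub⟩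
  · intro p σ' ha ⟨h1, h2, h3, h4⟩ hb
    have e4 := ha.rarr 4 rfl
    simp at e4
    have e9 : 0 < σ'.ireg 9 := by simpa [BExp.Holds, IExp.eval] using hb
    cases p with
    | zero => simp at h1; omega
    | succ p =>
      refine ⟨p, rfl, ?_⟩
      rw [← e4] at h4
      rw [Runs, wp_seq]
      refine (runs_playNode hW rfl e9 h2 h3 h4).wp fun τ σ'' hτ ha' ⟨h5, h6⟩ => ?_
      have e9' := ha'.ireg 9 rfl
      rw [wp_iset]
      simp only [IExp.eval, e9', IExp.cost, Memory.setI_ireg, Function.update_self,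
        Memory.setI_iarr]
      refine ⟨by omega, by omega, ?_, by omega, h5, by rwa [e4] at h6⟩
      rw [pow_succ] at h1
      omega
  · intro τ σ' hτ _ h
    refine ⟨?_, h⟩
    simp only [BExp.cost, IExp.cost] at hτ
    omega

theorem runs_insertQueue (hW : 2 * n ≤ W) {key : ℕ → ℝ} {Q : Finset ℕ}
    (h : QueueState n σ key Q) (hv : σ.ireg 10 < n) :
    Runs W insertQueue σ (110 * (Nat.log 2 n + 3)) fun σ' =>
      QueueState n σ' key (insert (σ.ireg 10) Q) := by
  rw [Runs, insertQueue, wp_seq, wp_iset]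
  refine ⟨by simp only [IExp.eval]; omega, ?_⟩
  refine (runs_updateQueue (key := key) (Q := Q) (Q' := insert (σ.ireg 10) Q) hW
    (h.congr (by simp) (by simp) (by simp)) ?_ ?_ ?_).wp ?_
  · simpa using hv
  · intro u hu; simp at hu; simp [hu]
  · simp [IExp.eval]
  · intro τ σ' hτ _ h'
    refine ⟨by simp only [IExp.cost]; omega, h'⟩

theorem runs_popQueue (hW : 2 * n ≤ W) {key : ℕ → ℝ} {Q : Finset ℕ}
    (h : QueueState n σ key Q) (hne : Q.Nonempty) :
    Runs W popQueue σ (110 * (Nat.log 2 n + 3)) fun σ' => σ'.ireg 10 ∈ Q ∧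
      (∀ u ∈ Q, key (σ'.ireg 10) ≤ key u) ∧ QueueState n σ' key (Q.erase (σ'.ireg 10)) := by
  obtain ⟨v, hv, e, hmin⟩ := h.isQueue.root h.subset hne
  have hvn := Finset.mem_range.1 (h.subset hv)
  simp only [Runs, popQueue, wp_seq, wp_iset, IExp.eval, IExp.cost, e, Nat.add_sub_cancel]
  refine ⟨by omega, by omega, ?_⟩
  refine (runs_updateQueue (key := key) (Q := Q) (Q' := Q.erase v) hW
    (h.congr (by simp) (by simp) (by simp)) ?_ ?_ ?_).wp ?_
  · simpa using hvn
  · intro u hu; simp at hu; simp [hu]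
  · simp
  · intro τ σ' hτ ha h'
    have e10 := ha.ireg 10 rfl
    simp at e10
    rw [e10]
    refine ⟨by omega, hv, fun u hu => ?_, h'⟩
    rw [← h.key_eq v hvn, ← h.key_eq u (Finset.mem_range.1 (h.subset hu))]
    exact hmin u hu

theorem runs_initQueue (hW : 2 * n ≤ W) (hn : σ.ireg 0 = n) (hent : ∀ i, σ.iarr 2 i ≤ n)
    {key : ℕ → ℝ} (hkey : ∀ v < n, σ.rarr 1 (σ.ireg 7 * n + v) = key v) :
    Runs W initQueue σ (100 * (n + 1)) fun σ' => QueueState n σ' key ∅ := by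
  rw [Runs, initQueue, wp_seq, wp_iset]
  refine ⟨by simp [IExp.eval], ?_⟩
  refine Runs.wp (Runs.loop (B := 90) (R := fun σ' => QueueState n σ' key ∅)
    (fun p σ' => σ'.ireg 8 + p = n ∧ (∀ i, σ'.iarr 2 i ≤ n) ∧
      (∀ v < σ'.ireg 8, σ'.rarr 4 v = key v ∧ σ'.iarr 2 v = 0 ∧ σ'.iarr 2 (n + v) = 0))
      _ n ?_ ?_ ?_) ?_
  · simpa [IExp.eval] using hent
  · intro p σ' ha ⟨h1, h2, h3⟩ hb
    have e0 := ha.ireg 0 rfl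
    simp [hn] at e0
    have e8 : σ'.ireg 8 = n := by
      have : n ≤ σ'.ireg 8 := by simpa [BExp.Holds, IExp.eval, e0] using hb
      omega
    rw [e8] at h3
    refine ⟨e0, fun v hv => (h3 v hv).1, h2, isQueue_empty _ fun i hi => ?_, by simp⟩
    rcases Nat.lt_or_ge i n with h | h
    · exact (h3 i h).2.1
    · have := (h3 (i - n) (by omega)).2.2
      rwa [Nat.add_sub_cancel' h] at this
  · intro p σ' ha ⟨h1, h2, h3⟩ hb
    have e0 := ha.ireg 0 rfl
    have e7 := ha.ireg 7 rfl
    have e1 := ha.rarr 1 rfl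
    simp [hn] at e0 e7 e1
    have e8 : σ'.ireg 8 < n := by simpa [BExp.Holds, IExp.eval, e0] using hb
    cases p with
    | zero => omega
    | succ p =>
      refine ⟨p, rfl, ?_⟩
      simp only [Runs, wp_seq, wp_iset, wp_iput, wp_rput, IExp.eval, RExp.eval, IExp.cost,
        RExp.cost, e0, e7, e1, Memory.setI_ireg, Memory.setI_iarr, Memory.setI_rarr,
        Memory.putI_ireg, Memory.putI_iarr, Memory.putI_rarr, Memory.putR_ireg, Memory.putR_iarr,
        Memory.putR_rarr, Function.update_self]
      refine ⟨by omega, by omega, by omega, by omega, by omega, by omega, by omega, by omega, ?_,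
        fun v hv => ?_⟩
      · intro i
        rw [Function.update_apply, Function.update_apply]
        have := h2 i
        split_ifs <;> omega
      · rcases Nat.lt_succ_iff_lt_or_eq.1 hv with hv | rfl
        · rw [Function.update_of_ne (by omega), Function.update_of_ne (by omega),
            Function.update_of_ne (by omega), Function.update_of_ne (by omega),
            Function.update_of_ne (by omega)]
          exact h3 v hv
        · rw [Function.update_self, hkey _ e8]
          refine ⟨rfl, ?_, Function.update_self ..⟩
          rw [Function.update_of_ne (by omega), Function.update_self]
  · intro τ σ' hτ _ h
    refine ⟨?_, h⟩
    simp only [BExp.cost, IExp.cost] at hτ ⊢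
    omega

end Specs

/-! # The lowest point of the `k`-th level of one edge -/

/-- At abscissa `t` at least `k` of the `n` chains `min (t + a v) (l - t + b v)` pass through or
below `(t, y)`. -/
def Feasible (n k : ℕ) (a b : ℕ → ℝ) (l t y : ℝ) : Prop :=
  0 ≤ t ∧ t ≤ l ∧ k ≤ ((Finset.range n).filter fun v => min (t + a v) (l - t + b v) ≤ y).card

/-- `(t, y)` is a lowest feasible point. -/
def IsLowestFeasible (n k : ℕ) (a b : ℕ → ℝ) (l t y : ℝ) : Prop :=
  Feasible n k a b l t y ∧ ∀ t' y', Feasible n k a b l t' y' → y ≤ y'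

/-- `A` lists `0, …, n - 1` in the order of their keys. -/
structure IsSortedList (n : ℕ) (a : ℕ → ℝ) (A : ℕ → ℕ) : Prop where
  lt : ∀ i < n, A i < n
  inj : ∀ i < n, ∀ j < n, A i = A j → i = j
  mono : ∀ i j, i ≤ j → j < n → a (A i) ≤ a (A j)

/-- The entries of the list `A` from number `i` on. -/
def tail (n : ℕ) (A : ℕ → ℕ) (i : ℕ) : Finset ℕ := (Finset.Ico i n).image A

theorem mem_tail {n : ℕ} {A : ℕ → ℕ} {i v : ℕ} :
    v ∈ tail n A i ↔ ∃ j, i ≤ j ∧ j < n ∧ A j = v := by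
  simp [tail, and_assoc]

theorem tail_eq_insert {n : ℕ} {A : ℕ → ℕ} {i : ℕ} (h : i < n) :
    tail n A i = insert (A i) (tail n A (i + 1)) := by
  rw [tail, tail, ← Finset.image_insert, Finset.insert_Ico_add_one_left_eq_Ico h]

/-- `β` is the value number `k - i` among the sorted values of `b` on the entries of `A` from
number `i` on. -/
def IsTailRank (n k : ℕ) (b : ℕ → ℝ) (A : ℕ → ℕ) (i : ℕ) (β : ℝ) : Prop :=
  ∃ T ⊆ tail n A i, T.card = k - i ∧ (∀ v ∈ T, b v ≤ β) ∧ (∃ v ∈ T, b v = β) ∧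
    ∀ v ∈ tail n A i, v ∉ T → β ≤ b v

/-- If `β' < β`, every vertex of `S` has a value below β, so `S` lies in the witness set `T` without
a vertex of value β, and is too small. -/
theorem IsTailRank.le {n k : ℕ} {b : ℕ → ℝ} {A : ℕ → ℕ} {i : ℕ} {β β' : ℝ}
    (h : IsTailRank n k b A i β) {S : Finset ℕ} (hS : S ⊆ tail n A i) (hk : k - i ≤ S.card)
    (hb : ∀ v ∈ S, b v ≤ β') : β ≤ β' := by
  obtain ⟨T, hT, hcard, hle, ⟨v₀, hv₀, rfl⟩, hge⟩ := h
  by_contra! hlt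
  have : S ⊆ T.erase v₀ := by
    intro v hv
    have h1 := hb v hv
    rw [Finset.mem_erase]
    constructor
    · rintro rfl; linarith
    · by_contra hvT
      have := hge v (hS hv) hvT
      linarith
  have h2 := Finset.card_le_card this
  rw [Finset.card_erase_of_mem hv₀] at h2
  have := Finset.card_pos.2 ⟨v₀, hv₀⟩
  omega

section

variable {n k : ℕ} {a b : ℕ → ℝ} {l : ℝ} {A : ℕ → ℕ}

theorem IsSortedList.card_image (hA : IsSortedList n a A) {i : ℕ} (hi : i ≤ n) :
    ((Finset.range i).image A).card = i := by
  rw [Finset.card_image_of_injOn, Finset.card_range]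
  intro x hx y hy h
  simp only [Finset.coe_range, Set.mem_Iio] at hx hy
  exact hA.inj x (by omega) y (by omega) h

theorem IsSortedList.image_range (hA : IsSortedList n a A) :
    (Finset.range n).image A = Finset.range n := by
  refine Finset.eq_of_subset_of_card_le ?_ ?_
  · intro v hv
    obtain ⟨i, hi, rfl⟩ := Finset.mem_image.1 hv
    exact Finset.mem_range.2 (hA.lt i (Finset.mem_range.1 hi))
  · rw [hA.card_image le_rfl, Finset.card_range]

theorem IsSortedList.disjoint_tail (hA : IsSortedList n a A) (i : ℕ) :
    Disjoint ((Finset.range i).image A) (tail n A i) := by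
  rw [Finset.disjoint_left]
  intro v hv hv'
  obtain ⟨j, hj, rfl⟩ := Finset.mem_image.1 hv
  obtain ⟨j', h1, h2, h3⟩ := mem_tail.1 hv'
  have hj := Finset.mem_range.1 hj
  have := hA.inj j' h2 j (by omega) h3
  omega

theorem IsSortedList.tail_subset (hA : IsSortedList n a A) (i : ℕ) :
    tail n A i ⊆ Finset.range n := by
  intro v hv
  obtain ⟨j, h1, h2, rfl⟩ := mem_tail.1 hv
  exact Finset.mem_range.2 (hA.lt j h2)

/-- The first `k` vertices of the list are within the stated height at the first endpoint. -/
theorem IsSortedList.feasible_start (hA : IsSortedList n a A) (hl : 0 ≤ l) (h1 : 1 ≤ k)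
    (hk : k ≤ n) : Feasible n k a b l 0 (a (A (k - 1))) := by
  refine ⟨le_rfl, hl, ?_⟩
  refine (hA.card_image hk).symm.le.trans (Finset.card_le_card fun v hv => ?_)
  obtain ⟨i, hi, rfl⟩ := Finset.mem_image.1 hv
  have := Finset.mem_range.1 hi
  rw [Finset.mem_filter, Finset.mem_range]
  refine ⟨hA.lt i (by omega), min_le_of_left_le ?_⟩
  rw [zero_add]
  exact hA.mono i (k - 1) (by omega) (by omega)

theorem IsSortedList.feasible_end (hA : IsSortedList n a A) (hl : 0 ≤ l) {β : ℝ}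
    (hβ : IsTailRank n k b A 0 β) : Feasible n k a b l l β := by
  obtain ⟨T, hT, hcard, hle, -, -⟩ := hβ
  refine ⟨hl, le_rfl, ?_⟩
  rw [Nat.sub_zero] at hcard
  rw [← hcard]
  refine Finset.card_le_card fun v hv => ?_
  rw [Finset.mem_filter]
  refine ⟨hA.tail_subset 0 (hT hv), min_le_of_right_le ?_⟩
  have := hle v hv
  linarith

/-- At this abscissa the rising part of `A (i - 1)` meets the falling part that ends at height β.
The first `i` vertices lie below the former and `k - i` vertices of the tail below the latter. The
abscissa is nonnegative by `hab` and the sorting; it is at most `l` exactly by `hle`. -/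
theorem IsSortedList.feasible_crossing (hA : IsSortedList n a A) (hk : k ≤ n)
    (hab : ∀ v < n, a v ≤ b v + l) {i : ℕ} (h0 : 0 < i) (hi : i < k) {β : ℝ}
    (hβ : IsTailRank n k b A i β) (hle : β ≤ a (A (i - 1)) + l) :
    Feasible n k a b l ((l + β - a (A (i - 1))) / 2) ((l + a (A (i - 1)) + β) / 2) := by
  obtain ⟨T, hT, hcard, hTle, ⟨v₀, hv₀, hv₀β⟩, -⟩ := hβ
  refine ⟨?_, by linarith, ?_⟩
  · obtain ⟨j, hj1, hj2, rfl⟩ := mem_tail.1 (hT hv₀)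
    have h1 := hab _ (hA.lt j hj2)
    have h2 := hA.mono (i - 1) j (by omega) hj2
    linarith
  · have hcard' : ((Finset.range i).image A ∪ T).card = k := by
      rw [Finset.card_union_of_disjoint
        (Finset.disjoint_of_subset_right hT (hA.disjoint_tail i)),
        hA.card_image (by omega), hcard]
      omega
    rw [← hcard']
    refine Finset.card_le_card fun v hv => ?_
    rw [Finset.mem_filter]
    rcases Finset.mem_union.1 hv with hv | hv
    · obtain ⟨j, hj, rfl⟩ := Finset.mem_image.1 hv
      have hj := Finset.mem_range.1 hj
      refine ⟨Finset.mem_range.2 (hA.lt j (by omega)), min_le_of_left_le ?_⟩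
      have := hA.mono j (i - 1) (by omega) (by omega)
      linarith
    · refine ⟨hA.tail_subset i (hT hv), min_le_of_right_le ?_⟩
      have := hTle v hv
      linarith

/-- A value below all candidates is below all feasible points. -/
theorem IsSortedList.le_of_feasible (hA : IsSortedList n a A) (h1 : 1 ≤ k) (hk : k ≤ n)
    (hba : ∀ v < n, b v ≤ a v + l) {y₀ : ℝ} (hstart : y₀ ≤ a (A (k - 1)))
    (hend : ∃ β, IsTailRank n k b A 0 β ∧ y₀ ≤ β)
    (hcross : ∀ i, 0 < i → i < k → ∃ β, IsTailRank n k b A i β ∧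
      (β ≤ a (A (i - 1)) + l → y₀ ≤ (l + a (A (i - 1)) + β) / 2))
    {t y : ℝ} (h : Feasible n k a b l t y) : y₀ ≤ y := by
  obtain ⟨ht0, htl, hcard⟩ := h
  -- `i` counts the vertices whose rising part is at height at most `y` at abscissa `t`; by the
  -- sorting they form a prefix.
  obtain ⟨i, hin, hlt, hge⟩ : ∃ i ≤ n, (∀ j < i, a (A j) ≤ y - t) ∧
      ∀ j, i ≤ j → j < n → y - t < a (A j) := by
    classical
    have hex : ∃ i, i = n ∨ y - t < a (A i) := ⟨n, .inl rfl⟩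
    have hmin : ∀ j < Nat.find hex, j ≠ n ∧ a (A j) ≤ y - t := fun j hj => by
      simpa using Nat.find_min hex hj
    refine ⟨Nat.find hex, Nat.find_min' hex (.inl rfl), fun j hj => (hmin j hj).2,
      fun j hj hjn => ?_⟩
    rcases Nat.find_spec hex with h | h
    · omega
    · exact h.trans_le (hA.mono _ j hj hjn)
  rcases Nat.lt_or_ge i k with hik | hik
  swap
  · have := hlt (k - 1) (by omega)
    linarith
  -- At least `k - i` of the chains counted at `(t, y)` belong to the tail; there the rising part is
  -- too high, so the falling part is at most `y`.
  have key : ∀ β, IsTailRank n k b A i β → β ≤ y - l + t := by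
    intro β hβ
    refine hβ.le (S := ((Finset.range n).filter fun v => min (t + a v) (l - t + b v) ≤ y) \
      (Finset.range i).image A) ?_ ?_ ?_
    · intro v hv
      rw [Finset.mem_sdiff, Finset.mem_filter, ← hA.image_range] at hv
      obtain ⟨⟨hv, -⟩, hv'⟩ := hv
      obtain ⟨j, hj, rfl⟩ := Finset.mem_image.1 hv
      refine mem_tail.2 ⟨j, ?_, Finset.mem_range.1 hj, rfl⟩
      by_contra! hji
      exact hv' (Finset.mem_image_of_mem _ (Finset.mem_range.2 hji))
    · have := Finset.le_card_sdiff ((Finset.range i).image A)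
        ((Finset.range n).filter fun v => min (t + a v) (l - t + b v) ≤ y)
      rw [hA.card_image hin] at this
      omega
    · intro v hv
      rw [Finset.mem_sdiff, Finset.mem_filter, ← hA.image_range] at hv
      obtain ⟨⟨hv, hvy⟩, hv'⟩ := hv
      obtain ⟨j, hj, rfl⟩ := Finset.mem_image.1 hv
      have hij : i ≤ j := by
        by_contra! hji
        exact hv' (Finset.mem_image_of_mem _ (Finset.mem_range.2 hji))
      have := hge j hij (Finset.mem_range.1 hj)
      rcases min_le_iff.1 hvy with h | h <;> linarith
  obtain ⟨β₀, hβ₀, hy₀⟩ := hend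
  rcases Nat.eq_zero_or_pos i with rfl | h0
  · have := key β₀ hβ₀
    linarith
  obtain ⟨β, hβ, hcand⟩ := hcross i h0 hik
  have h2 := key β hβ
  have h3 := hlt (i - 1) (by omega)
  rcases le_or_gt β (a (A (i - 1)) + l) with hle | hgt
  · have h4 := hcand hle
    linarith
  -- The crossing would lie beyond the second endpoint. Then `b ≤ a + l` puts the whole prefix below
  -- β, so together with the tail there are `k` vertices with `b`-value at most β, and the candidate
  -- above the second endpoint is no higher.
  · have : β₀ ≤ β := by
      obtain ⟨T, hT, hTcard, hTle, -, -⟩ := id hβ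
      refine hβ₀.le (S := (Finset.range i).image A ∪ T) ?_ ?_ ?_
      · intro v hv
        rcases Finset.mem_union.1 hv with hv | hv
        · obtain ⟨j, hj, rfl⟩ := Finset.mem_image.1 hv
          have := Finset.mem_range.1 hj
          exact mem_tail.2 ⟨j, by omega, by omega, rfl⟩
        · obtain ⟨j, hj1, hj2, rfl⟩ := mem_tail.1 (hT hv)
          exact mem_tail.2 ⟨j, by omega, hj2, rfl⟩
      · rw [Finset.card_union_of_disjoint
          (Finset.disjoint_of_subset_right hT (hA.disjoint_tail i)),
          hA.card_image (by omega), hTcard]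
        omega
      · intro v hv
        rcases Finset.mem_union.1 hv with hv | hv
        · obtain ⟨j, hj, rfl⟩ := Finset.mem_image.1 hv
          have hj := Finset.mem_range.1 hj
          have := hA.mono j (i - 1) (by omega) (by omega)
          have := hba _ (hA.lt j (by omega))
          linarith
        · exact hTle v hv
    linarith

end

/-! # The algorithm for one edge -/

/-- Insert the vertices `e`, the counter `ireg 8` running up to `n`. -/
def insertAll (e : IExp) : Program :=
  .loop (.ilt (.reg 8) (.reg 0)) <|
    .seq (.iset 10 e) <| .seq insertQueue <| .iset 8 (.add (.reg 8) (.lit 1))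

/-- Empty the queue into the list of integer array `3`. -/
def extractAll : Program :=
  .seq (.iset 8 (.lit 0)) <|
  .loop (.ilt (.reg 8) (.reg 0)) <|
    .seq popQueue <| .seq (.iput 3 (.reg 8) (.reg 10)) <| .iset 8 (.add (.reg 8) (.lit 1))

/-- Sort the vertices by their distance from the vertex `ireg 5`. -/
def sortVertices : Program :=
  .seq (.iset 7 (.reg 5)) <| .seq initQueue <| .seq (.iset 8 (.lit 0)) <|
  .seq (insertAll (.reg 8)) extractAll

section

variable {W n : ℕ} {σ : Memory}

/-- Stated for an arbitrary expression because it is used twice: with the counter itself to sort all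
vertices, and with the entries of the sorted list from number `k` on to prepare the sweep. -/
theorem runs_insertAll (hW : 2 * n ≤ W) {e : IExp} (he : e.cost ≤ 9) {key : ℕ → ℝ} {i₀ : ℕ}
    (hi₀ : σ.ireg 8 = i₀) (h : QueueState n σ key ∅) (hi : i₀ ≤ n) {f : ℕ → ℕ}
    (hf : ∀ i < n, f i < n)
    (hef : ∀ σ', (insertAll e).Agree σ σ' → e.eval σ' = f (σ'.ireg 8)) :
    Runs W (insertAll e) σ ((n + 1) * (120 * (Nat.log 2 n + 3))) fun σ' =>
      QueueState n σ' key ((Finset.Ico i₀ n).image f) := by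
  refine (Runs.loop_le (B := 110 * (Nat.log 2 n + 3) + 20)
    (D := 120 * (Nat.log 2 n + 3))
    (fun p σ' => σ'.ireg 8 + p = n ∧ i₀ ≤ σ'.ireg 8 ∧
      QueueState n σ' key ((Finset.Ico i₀ (σ'.ireg 8)).image f)) _ (n - i₀) ?_ ?_ ?_ ?_).mono
      ?_ fun _ _ h => h
  · rw [hi₀]; exact ⟨by omega, le_rfl, by simpa using h⟩
  · intro p σ' ha ⟨h1, h2, h3⟩ hb
    have e8 : σ'.ireg 8 = n := by
      have : n ≤ σ'.ireg 8 := by simpa [BExp.Holds, IExp.eval, h3.size] using hb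
      omega
    rwa [e8] at h3
  · intro p σ' ha ⟨h1, h2, h3⟩ hb
    have e8 : σ'.ireg 8 < n := by simpa [BExp.Holds, IExp.eval, h3.size] using hb
    have hlt := hf _ e8
    cases p with
    | zero => omega
    | succ p =>
      refine ⟨p, rfl, ?_⟩
      have hev := hef σ' ⟨ha.1, ha.2, ha.3, ha.4⟩
      rw [Runs, wp_seq, wp_iset, hev]
      refine ⟨by omega, ?_⟩
      rw [wp_seq]
      refine (runs_insertQueue hW (h3.congr (by simp) (by simp) (by simp)) (by simpa)).wp ?_
      intro τ σ'' hτ ha' h'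
      have e8' := ha'.ireg 8 rfl
      simp at e8' h'
      rw [wp_iset]
      simp only [IExp.eval, IExp.cost, e8', Memory.setI_ireg, Function.update_self]
      refine ⟨by omega, by omega, by omega, by omega, ?_⟩
      have := h'.congr (σ' := σ''.setI 8 (σ'.ireg 8 + 1)) (by simp) (by simp) (by simp)
      rwa [← Finset.image_insert, Finset.insert_Ico_right_eq_Ico_add_one h2] at this
  · simp only [BExp.cost, IExp.cost]
    omega
  · exact Nat.mul_le_mul_right _ (by omega)

theorem runs_extractAll (hW : 2 * n ≤ W) {key : ℕ → ℝ}
    (h : QueueState n σ key (Finset.range n)) :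
    Runs W extractAll σ ((n + 2) * (120 * (Nat.log 2 n + 3))) fun σ' =>
      (∀ i, σ'.iarr 2 i ≤ n) ∧ IsSortedList n key (σ'.iarr 3) := by
  rw [Runs, extractAll, wp_seq, wp_iset]
  refine ⟨by simp [IExp.eval], ?_⟩
  -- Invariant of selection sort: the extracted list is sorted and free of repetitions, and its keys
  -- are at most every key left in the queue.
  refine (Runs.loop_le (B := 110 * (Nat.log 2 n + 3) + 20) (D := 120 * (Nat.log 2 n + 3))
    (R := fun σ' => (∀ i, σ'.iarr 2 i ≤ n) ∧ IsSortedList n key (σ'.iarr 3))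
    (fun p σ' => σ'.ireg 8 + p = n ∧ ∃ Q, QueueState n σ' key Q ∧ Q.card = p ∧
      (∀ i j, i ≤ j → j < σ'.ireg 8 → key (σ'.iarr 3 i) ≤ key (σ'.iarr 3 j)) ∧
      (∀ i < σ'.ireg 8, ∀ j < σ'.ireg 8, σ'.iarr 3 i = σ'.iarr 3 j → i = j) ∧
      ∀ i < σ'.ireg 8, σ'.iarr 3 i < n ∧ σ'.iarr 3 i ∉ Q ∧
        ∀ v ∈ Q, key (σ'.iarr 3 i) ≤ key v) _ n ?_ ?_ ?_ ?_).wp ?_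
  · refine ⟨by simp [IExp.eval], _, h.congr (by simp) (by simp) (by simp), by simp, ?_⟩
    simp [IExp.eval]
  · rintro p σ' ha ⟨h1, Q, h2, h3, h4, h5, h6⟩ hb
    have e8 : σ'.ireg 8 = n := by
      have : n ≤ σ'.ireg 8 := by simpa [BExp.Holds, IExp.eval, h2.size] using hb
      omega
    rw [e8] at h4 h5 h6
    exact ⟨h2.entry_le, fun i hi => (h6 i hi).1, h5, h4⟩
  · rintro p σ' ha ⟨h1, Q, h2, h3, h4, h5, h6⟩ hb
    have e8 : σ'.ireg 8 < n := by simpa [BExp.Holds, IExp.eval, h2.size] using hb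
    cases p with
    | zero => omega
    | succ p =>
      refine ⟨p, rfl, ?_⟩
      rw [Runs, wp_seq]
      refine (runs_popQueue hW h2 (Finset.card_pos.1 (by omega))).wp ?_
      intro τ σ'' hτ ha' ⟨h7, h8, h9⟩
      have e8' := ha'.ireg 8 rfl
      have e3' := ha'.iarr 3 rfl
      generalize hx : σ''.ireg 10 = x at h7 h8 h9
      have hxn := Finset.mem_range.1 (h2.subset h7)
      simp only [wp_seq, wp_iput, wp_iset, IExp.eval, IExp.cost, Memory.setI_ireg,
        Memory.setI_iarr, Memory.putI_ireg, Memory.putI_iarr, Function.update_self, e8', e3', hx]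
      refine ⟨by omega, by omega, by omega, by omega, by omega, Q.erase x,
        h9.congr (by simp) (by simp) (by simp), ?_, ?_, ?_, ?_⟩
      · rw [Finset.card_erase_of_mem h7]; omega
      · intro i j hij hj
        rcases Nat.lt_succ_iff_lt_or_eq.1 hj with hj | rfl
        · rw [Function.update_of_ne (by omega), Function.update_of_ne (by omega)]
          exact h4 i j hij hj
        · rw [Function.update_self]
          rcases Nat.lt_or_eq_of_le hij with hij | rfl
          · rw [Function.update_of_ne (by omega)]
            exact (h6 i hij).2.2 x h7
          · rw [Function.update_self]
      · intro i hi j hj hij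
        rcases Nat.lt_succ_iff_lt_or_eq.1 hi with hi | rfl <;>
        rcases Nat.lt_succ_iff_lt_or_eq.1 hj with hj | rfl
        · rw [Function.update_of_ne (by omega), Function.update_of_ne (by omega)] at hij
          exact h5 i hi j hj hij
        · rw [Function.update_of_ne (by omega), Function.update_self] at hij
          exact absurd (hij ▸ h7) (h6 i hi).2.1
        · rw [Function.update_of_ne (a := j) (by omega), Function.update_self] at hij
          exact absurd (hij ▸ h7) (h6 j hj).2.1
        · rfl
      · intro i hi
        rcases Nat.lt_succ_iff_lt_or_eq.1 hi with hi | rfl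
        · rw [Function.update_of_ne (by omega)]
          obtain ⟨g1, g2, g3⟩ := h6 i hi
          exact ⟨g1, fun hm => g2 (Finset.mem_of_mem_erase hm),
            fun v hv => g3 v (Finset.mem_of_mem_erase hv)⟩
        · rw [Function.update_self]
          exact ⟨hxn, Finset.notMem_erase _ _, fun v hv => h8 v (Finset.mem_of_mem_erase hv)⟩
  · simp only [BExp.cost, IExp.cost]
    omega
  · intro τ σ' hτ _ h
    refine ⟨?_, h⟩
    simp only [IExp.cost]
    have : (n + 2) * (120 * (Nat.log 2 n + 3)) =
      (n + 1) * (120 * (Nat.log 2 n + 3)) + 120 * (Nat.log 2 n + 3) := by ring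
    omega

theorem runs_sortVertices (hW : 2 * n ≤ W) (hn : σ.ireg 0 = n) (hr : σ.ireg 5 < n)
    (hent : ∀ i, σ.iarr 2 i ≤ n) {a : ℕ → ℝ}
    (ha : ∀ v < n, σ.rarr 1 (σ.ireg 5 * n + v) = a v) :
    Runs W sortVertices σ ((n + 2) * (300 * (Nat.log 2 n + 3))) fun σ' =>
      (∀ i, σ'.iarr 2 i ≤ n) ∧ IsSortedList n a (σ'.iarr 3) := by
  rw [Runs, sortVertices, wp_seq, wp_iset]
  refine ⟨by simp only [IExp.eval]; omega, ?_⟩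
  rw [wp_seq]
  refine (runs_initQueue hW (n := n) (key := a) (by simpa) (by simpa) ?_).wp ?_
  · simpa [IExp.eval] using ha
  intro τ₁ σ₁ hτ₁ _ h₁
  rw [wp_seq, wp_iset]
  refine ⟨by simp [IExp.eval], ?_⟩
  rw [wp_seq]
  refine (runs_insertAll hW (by simp [IExp.cost]) (i₀ := 0) (f := fun i => i) (by simp [IExp.eval])
    (h₁.congr (by simp) (by simp) (by simp)) (Nat.zero_le _) (fun i hi => hi)
    (fun _ _ => rfl)).wp ?_
  intro τ₂ σ₂ hτ₂ _ h₂
  rw [Finset.image_id', ← Finset.range_eq_Ico] at h₂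
  refine (runs_extractAll hW h₂).wp ?_
  intro τ₃ σ₃ hτ₃ _ h₃
  refine ⟨?_, h₃⟩
  simp only [IExp.cost]
  nlinarith

end

/-- Insert the vertex number `ireg 8 - 1` of the sorted list into the queue, extract a vertex with
least key, and raise `rreg 3` to its key. -/
def nextRank : Program :=
  .seq (.iset 8 (.sub (.reg 8) (.lit 1))) <| .seq (.iset 10 (.arr 3 (.reg 8))) <|
  .seq insertQueue <| .seq popQueue <|
  .ite (.rlt (.reg 3) (.arr 4 (.reg 10))) (.rset 3 (.arr 4 (.reg 10))) .skip

/-- Compare the best point `(rreg 5, rreg 6)` with the crossing of the rising part of the chain of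
the vertex number `ireg 8 - 1` of the sorted list and a falling part that ends at
height `rreg 3`. -/
def tryCrossing : Program :=
  .ite (.ilt (.lit 0) (.reg 8))
    (.seq (.rset 4 (.arr 1 (.add (.mul (.reg 5) (.reg 0)) (.arr 3 (.sub (.reg 8) (.lit 1))))))
      (.ite (.conj (.neg (.rlt (.add (.reg 4) (.reg 2)) (.reg 3)))
          (.rlt (.div (.add (.add (.reg 2) (.reg 4)) (.reg 3)) (.lit 2)) (.reg 6)))
        (.seq (.rset 5 (.div (.sub (.add (.reg 2) (.reg 3)) (.reg 4)) (.lit 2)))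
          (.rset 6 (.div (.add (.add (.reg 2) (.reg 4)) (.reg 3)) (.lit 2)))) .skip))
    .skip

/-- Compare the best point `(rreg 5, rreg 6)` with the point of height `rreg 3` above the second
endpoint. -/
def tryEnd : Program :=
  .ite (.rlt (.reg 3) (.reg 6))
    (.seq (.rset 5 (.reg 2)) (.rset 6 (.reg 3))) .skip

/-- The loop through all candidates. -/
def sweepLoop : Program := .loop (.ilt (.lit 0) (.reg 8)) (.seq nextRank tryCrossing)

/-- Find the best point of the edge with endpoints `ireg 5`, `ireg 6` and length
`rreg 2`, when the vertices are sorted by their distance from `ireg 5`. -/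
def sweepEdge : Program :=
  .seq (.iset 7 (.reg 6)) <| .seq initQueue <| .seq (.iset 8 (.reg 2)) <|
  .seq (insertAll (.arr 3 (.reg 8))) <|
  .seq (.rset 3 (.lit 0)) <|
  .seq (.rset 5 (.lit 0)) <|
  .seq (.rset 6
    (.arr 1 (.add (.mul (.reg 5) (.reg 0)) (.arr 3 (.sub (.reg 2) (.lit 1)))))) <|
  .seq (.iset 8 (.reg 2)) <| .seq sweepLoop tryEnd

/-- The data of the sweep that do not change. -/
structure SweepContext (n : ℕ) (a : ℕ → ℝ) (l : ℝ) (A : ℕ → ℕ) (σ : Memory) : Prop where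
  size : σ.ireg 0 = n
  row : ∀ v < n, σ.rarr 1 (σ.ireg 5 * n + v) = a v
  length : σ.rreg 2 = l
  list : σ.iarr 3 = A

theorem SweepContext.congr {n : ℕ} {a : ℕ → ℝ} {l : ℝ} {A : ℕ → ℕ} {σ σ' : Memory}
    (h : SweepContext n a l A σ) (h0 : σ'.ireg 0 = σ.ireg 0) (h5 : σ'.ireg 5 = σ.ireg 5)
    (h1 : σ'.rarr 1 = σ.rarr 1) (h2 : σ'.rreg 2 = σ.rreg 2)
    (h3 : σ'.iarr 3 = σ.iarr 3) : SweepContext n a l A σ' :=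
  ⟨h0 ▸ h.size, h5 ▸ h1 ▸ h.row, h2 ▸ h.length, h3 ▸ h.list⟩

/-- `rreg 3` is the value number `k - i` on the tail of the list `A` from number `i` on, and the
queue holds the vertices of the tail that do not count for it. -/
def RankState (n k : ℕ) (b : ℕ → ℝ) (A : ℕ → ℕ) (i : ℕ) (σ : Memory) : Prop :=
  ∃ T Q : Finset ℕ, QueueState n σ b Q ∧ (∀ v, v ∈ tail n A i ↔ v ∈ T ∨ v ∈ Q) ∧ T.card = k - i ∧
    (∀ v ∈ T, v ∉ Q) ∧ (∀ v ∈ T, b v ≤ σ.rreg 3) ∧ (∀ v ∈ Q, σ.rreg 3 ≤ b v) ∧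
    if i < k then ∃ v ∈ T, b v = σ.rreg 3 else ∀ v < n, σ.rreg 3 ≤ b v

/-- At `i = k` the set `T` is empty and there is no value of rank zero; the register then holds only
a lower bound of all `b`-values. -/
theorem RankState.isTailRank {n k : ℕ} {b : ℕ → ℝ} {A : ℕ → ℕ} {i : ℕ} {σ : Memory}
    (h : RankState n k b A i σ) (hi : i < k) : IsTailRank n k b A i (σ.rreg 3) := by
  obtain ⟨T, Q, h1, h2, h3, h4, h5, h6, h7⟩ := h
  rw [if_pos hi] at h7
  refine ⟨T, fun v hv => (h2 v).2 (.inl hv), h3, h5, h7, fun v hv hvT => h6 v ?_⟩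
  exact ((h2 v).1 hv).resolve_left hvT

theorem RankState.congr {n k : ℕ} {b : ℕ → ℝ} {A : ℕ → ℕ} {i : ℕ} {σ σ' : Memory}
    (h : RankState n k b A i σ) (h0 : σ'.ireg 0 = σ.ireg 0) (h2 : σ'.iarr 2 = σ.iarr 2)
    (h4 : σ'.rarr 4 = σ.rarr 4) (h3 : σ'.rreg 3 = σ.rreg 3) : RankState n k b A i σ' := by
  obtain ⟨T, Q, hQ, h⟩ := h
  exact ⟨T, Q, hQ.congr h0 h2 h4, h3 ▸ h⟩

/-- The point `(rreg 5, rreg 6)` is the best candidate with a number at least `i`. -/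
def BestState (n k : ℕ) (a b : ℕ → ℝ) (l : ℝ) (A : ℕ → ℕ) (i : ℕ) (σ : Memory) : Prop :=
  Feasible n k a b l (σ.rreg 5) (σ.rreg 6) ∧ σ.rreg 6 ≤ a (A (k - 1)) ∧
    ∀ i', i ≤ i' → 0 < i' → i' < k → ∃ β, IsTailRank n k b A i' β ∧
      (β ≤ a (A (i' - 1)) + l → σ.rreg 6 ≤ (l + a (A (i' - 1)) + β) / 2)

section

variable {W n k : ℕ} {σ : Memory} {a b : ℕ → ℝ} {l : ℝ} {A : ℕ → ℕ}

/-- The tail gains `A i` and the rank grows by one, so `T` gains exactly one vertex: the least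
vertex `x` among `A i` and the old queue. If `x` has a value below the old β, then β stays;
otherwise it becomes `b x`. -/
theorem runs_nextRank (hW : 2 * n ≤ W) (hk : k ≤ n) (hA : IsSortedList n a A)
    (hlist : σ.iarr 3 = A) {i : ℕ} (hi : i < k) (hσ : σ.ireg 8 = i + 1)
    (h : RankState n k b A (i + 1) σ) :
    Runs W nextRank σ (230 * (Nat.log 2 n + 3)) fun σ' =>
      σ'.ireg 8 = i ∧ RankState n k b A i σ' := by
  obtain ⟨T, Q, h1, h2, h3, h4, h5, h6, h7⟩ := h
  have hAi : A i < n := hA.lt i (by omega)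
  have htail : ∀ v, v ∈ tail n A i ↔ v = A i ∨ v ∈ T ∨ v ∈ Q := by
    intro v
    rw [tail_eq_insert (by omega), Finset.mem_insert, h2]
  have hnew : A i ∉ T ∧ A i ∉ Q := by
    rw [← not_or, ← h2]
    intro hmem
    obtain ⟨j, hj1, hj2, hj3⟩ := mem_tail.1 hmem
    have := hA.inj j hj2 i (by omega) hj3
    omega
  simp only [Runs, nextRank, wp_seq, wp_iset, IExp.eval, IExp.cost, hσ, Memory.setI_ireg,
    Memory.setI_iarr, Function.update_self, hlist, Nat.add_sub_cancel]
  refine ⟨by omega, by omega, ?_⟩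
  refine (runs_insertQueue hW (h1.congr (by simp) (by simp) (by simp)) (by simpa)).wp ?_
  intro τ₁ σ₁ hτ₁ ha₁ h₁
  simp only [Memory.setI_ireg, Function.update_self] at h₁
  rw [wp_seq]
  refine (runs_popQueue hW h₁ (Finset.insert_nonempty _ _)).wp ?_
  intro τ₂ σ₂ hτ₂ ha₂ ⟨hx, hxmin, h₂⟩
  have e8 : σ₂.ireg 8 = i := by
    rw [ha₂.ireg 8 rfl, ha₁.ireg 8 rfl]
    simp
  have e3 : σ₂.rreg 3 = σ.rreg 3 := by
    rw [ha₂.rreg 3 rfl, ha₁.rreg 3 rfl]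
    simp
  generalize hx' : σ₂.ireg 10 = x at hx hxmin h₂
  have hxn : x < n := Finset.mem_range.1 (h₁.subset hx)
  have hkx := h₂.key_eq x hxn
  have hxT : x ∉ T := by
    intro hxT
    rcases Finset.mem_insert.1 hx with rfl | hxQ
    · exact hnew.1 hxT
    · exact h4 x hxT hxQ
  have final : ∀ σ', QueueState n σ' b ((insert (A i) Q).erase x) →
      σ'.rreg 3 = max (σ.rreg 3) (b x) → RankState n k b A i σ' := by
    intro σ' hq hβ
    refine ⟨insert x T, _, hq, ?_, ?_, ?_, ?_, ?_, ?_⟩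
    · intro v
      rw [htail, Finset.mem_insert, Finset.mem_erase, Finset.mem_insert]
      by_cases hv : v = x
      · subst hv
        have := Finset.mem_insert.1 hx
        tauto
      · simp only [hv, false_or, ne_eq, not_false_eq_true, true_and]
        tauto
    · rw [Finset.card_insert_of_notMem hxT]; omega
    · intro v hv
      rw [Finset.mem_erase, Finset.mem_insert]
      rcases Finset.mem_insert.1 hv with rfl | hv
      · simp
      · rintro ⟨-, rfl | h⟩
        · exact hnew.1 hv
        · exact h4 v hv h
    · intro v hv
      rw [hβ]
      rcases Finset.mem_insert.1 hv with rfl | hv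
      · exact le_max_right _ _
      · exact (h5 v hv).trans (le_max_left _ _)
    · intro v hv
      rw [hβ]
      obtain ⟨hvx, hv⟩ := Finset.mem_erase.1 hv
      refine max_le ?_ (hxmin v hv)
      -- If `A i` stays in the queue, then `x` came from the old queue, and the old β is at most `b
      -- x`, which is at most `b (A i)`.
      rcases Finset.mem_insert.1 hv with rfl | hvQ
      · have hxQ : x ∈ Q := (Finset.mem_insert.1 hx).resolve_left fun h => hvx h.symm
        exact (h6 x hxQ).trans (hxmin _ hv)
      · exact h6 v hvQ
    · rw [if_pos hi, hβ]
      rcases max_choice (σ.rreg 3) (b x) with hm | hm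
      · split_ifs at h7 with hik
        · obtain ⟨v, hv, hv'⟩ := h7
          exact ⟨v, Finset.mem_insert_of_mem hv, by rw [hm, hv']⟩
        -- In the first round the old β is a lower bound of all values, so the maximum is attained
        -- at `x`.
        · exact ⟨x, Finset.mem_insert_self _ _, (max_eq_right (h7 x hxn)).symm⟩
      · exact ⟨x, Finset.mem_insert_self _ _, hm.symm⟩
  simp only [wp_ite, wp_rset, wp_skip, BExp.Holds, RExp.eval, BExp.cost, RExp.cost, IExp.eval,
    IExp.cost, hx', hkx, e3, Memory.setR_ireg]
  refine ⟨fun hlt => ⟨by omega, e8, final _ (h₂.congr (by simp) (by simp) (by simp)) ?_⟩,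
    fun hge => ⟨by omega, e8, final _ h₂ ?_⟩⟩
  · simp [max_eq_right hlt.le]
  · rw [e3, max_eq_left (not_lt.1 hge)]

theorem runs_tryCrossing (hk : k ≤ n) (hA : IsSortedList n a A)
    (hab : ∀ v < n, a v ≤ b v + l) (hc : SweepContext n a l A σ) {i : ℕ} (hi : i < k)
    (hσ : σ.ireg 8 = i) (hr : IsTailRank n k b A i (σ.rreg 3))
    (h : BestState n k a b l A (i + 1) σ) :
    Runs W tryCrossing σ 60 (BestState n k a b l A i) := by
  obtain ⟨h1, h2, h3⟩ := h
  have hAi : A (i - 1) < n := hA.lt _ (by omega)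
  -- Common to all outcomes of the tests: the best point is replaced, kept, or `i = 0` and there is
  -- no crossing to try.
  have hstep : ∀ σ' : Memory, Feasible n k a b l (σ'.rreg 5) (σ'.rreg 6) →
      σ'.rreg 6 ≤ σ.rreg 6 → (0 < i → σ.rreg 3 ≤ a (A (i - 1)) + l →
        σ'.rreg 6 ≤ (l + a (A (i - 1)) + σ.rreg 3) / 2) → BestState n k a b l A i σ' := by
    intro σ' g1 g2 g3
    refine ⟨g1, g2.trans h2, fun i' hi' h0 hk' => ?_⟩
    rcases Nat.lt_or_eq_of_le hi' with hlt | rfl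
    · obtain ⟨β, hβ, hle⟩ := h3 i' hlt h0 hk'
      exact ⟨β, hβ, fun hβ' => g2.trans (hle hβ')⟩
    · exact ⟨_, hr, g3 h0⟩
  simp only [Runs, tryCrossing, wp_ite, wp_seq, wp_rset, wp_skip, BExp.Holds, RExp.eval,
    IExp.eval, BExp.cost, RExp.cost, IExp.cost, hσ, hc.size, hc.list, hc.length,
    hc.row _ hAi, Memory.setR_rreg, Function.update_self, Nat.cast_ofNat,
    Function.update_of_ne (show (2 : ℕ) ≠ 4 by decide),
    Function.update_of_ne (show (3 : ℕ) ≠ 4 by decide),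
    Function.update_of_ne (show (6 : ℕ) ≠ 4 by decide)]
  refine ⟨fun h0 => ⟨fun ⟨hle, hlt⟩ => ⟨by omega, hstep _ ?_ ?_ ?_⟩,
    fun hn => ⟨by omega, hstep _ ?_ ?_ ?_⟩⟩, fun h0 => ⟨by omega, hstep _ h1 le_rfl ?_⟩⟩
  · simpa [hc.length] using hA.feasible_crossing hk hab h0 hi hr (not_lt.1 hle)
  · simpa [hc.length] using hlt.le
  · simp [hc.length]
  · simpa using h1
  · simp
  · intro _ hle
    simp only [Memory.setR_rreg, Function.update_of_ne (show (6 : ℕ) ≠ 4 by decide)]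
    by_contra! hlt
    exact hn ⟨not_lt.2 hle, hlt⟩
  · intro h; exact absurd h h0

theorem runs_sweepLoop (hW : 2 * n ≤ W) (hk : k ≤ n) (hA : IsSortedList n a A)
    (hab : ∀ v < n, a v ≤ b v + l) (hc : SweepContext n a l A σ) (hσ : σ.ireg 8 = k)
    (hr : RankState n k b A k σ) (hb : BestState n k a b l A k σ) :
    Runs W sweepLoop σ ((n + 1) * (260 * (Nat.log 2 n + 3))) fun σ' =>
      RankState n k b A 0 σ' ∧ BestState n k a b l A 0 σ' := by
  refine (Runs.loop_le (B := 230 * (Nat.log 2 n + 3) + 60) (D := 260 * (Nat.log 2 n + 3))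
    (fun p σ' => σ'.ireg 8 = p ∧ p ≤ k ∧ RankState n k b A p σ' ∧ BestState n k a b l A p σ')
    σ k ⟨hσ, le_rfl, hr, hb⟩ ?_ ?_ ?_).mono (Nat.mul_le_mul_right _ (by omega)) fun _ _ h => h
  · intro p σ' ha ⟨h1, h2, h3⟩ hb
    obtain rfl : p = 0 := by simpa [BExp.Holds, IExp.eval, h1] using hb
    exact h3
  · intro p σ' ha ⟨h1, h2, h3, h4⟩ hb
    cases p with
    | zero => simp [BExp.Holds, IExp.eval, h1] at hb
    | succ p =>
      refine ⟨p, rfl, ?_⟩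
      have hc' := hc.congr (ha.ireg 0 rfl) (ha.ireg 5 rfl) (ha.rarr 1 rfl)
        (ha.rreg 2 rfl) (ha.iarr 3 rfl)
      rw [Runs, wp_seq]
      refine (runs_nextRank hW hk hA hc'.list (by omega) h1 h3).wp ?_
      intro τ₁ σ₁ hτ₁ ha₁ ⟨e8, hr₁⟩
      have hc₁ := hc'.congr (ha₁.ireg 0 rfl) (ha₁.ireg 5 rfl) (ha₁.rarr 1 rfl)
        (ha₁.rreg 2 rfl) (ha₁.iarr 3 rfl)
      have hb₁ : BestState n k a b l A (p + 1) σ₁ := by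
        rw [BestState, ha₁.rreg 5 rfl, ha₁.rreg 6 rfl]
        exact h4
      refine (runs_tryCrossing hk hA hab hc₁ (by omega) e8 (hr₁.isTailRank (by omega))
        hb₁).wp ?_
      intro τ₂ σ₂ hτ₂ ha₂ hb₂
      exact ⟨by omega, (ha₂.ireg 8 rfl).trans e8, by omega, hr₁.congr (ha₂.ireg 0 rfl)
        (ha₂.iarr 2 rfl) (ha₂.rarr 4 rfl) (ha₂.rreg 3 rfl), hb₂⟩
  · simp only [BExp.cost, IExp.cost]
    omega

theorem runs_sweepEdge (hW : 2 * n ≤ W) (h1 : 1 ≤ k) (hkn : k ≤ n) (hk : σ.ireg 2 = k)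
    (hA : IsSortedList n a A) (hl : 0 ≤ l) (hab : ∀ v < n, a v ≤ b v + l)
    (hba : ∀ v < n, b v ≤ a v + l) (hb : ∀ v < n, 0 ≤ b v) (hc : SweepContext n a l A σ)
    (hs : σ.ireg 6 < n) (hent : ∀ i, σ.iarr 2 i ≤ n)
    (hrow : ∀ v < n, σ.rarr 1 (σ.ireg 6 * n + v) = b v) :
    Runs W sweepEdge σ ((n + 2) * (600 * (Nat.log 2 n + 3))) fun σ' =>
      (∀ i, σ'.iarr 2 i ≤ n) ∧ IsLowestFeasible n k a b l (σ'.rreg 5) (σ'.rreg 6) := by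
  rw [Runs, sweepEdge, wp_seq, wp_iset]
  refine ⟨by simp only [IExp.eval]; omega, ?_⟩
  rw [wp_seq]
  refine (runs_initQueue hW (n := n) (key := b) (by simpa using hc.size) (by simpa) ?_).wp ?_
  · simpa [IExp.eval] using hrow
  intro τ₁ σ₁ hτ₁ ha₁ hq₁
  have hc₁ : SweepContext n a l A σ₁ := by
    refine hc.congr ?_ ?_ ?_ ?_ ?_
    · rw [ha₁.ireg 0 rfl]; simp
    · rw [ha₁.ireg 5 rfl]; simp
    · rw [ha₁.rarr 1 rfl]; simp
    · rw [ha₁.rreg 2 rfl]; simp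
    · rw [ha₁.iarr 3 rfl]; simp
  have hk₁ : σ₁.ireg 2 = k := by rw [ha₁.ireg 2 rfl]; simpa using hk
  rw [wp_seq, wp_iset]
  refine ⟨by simp only [IExp.eval]; omega, ?_⟩
  rw [wp_seq]
  refine (runs_insertAll hW (by simp [IExp.cost]) (i₀ := k) (f := A) (by simp [IExp.eval, hk₁])
    (hq₁.congr (by simp) (by simp) (by simp)) hkn hA.lt ?_).wp ?_
  · intro σ' ha'
    simp [IExp.eval, ha'.iarr 3 rfl, hc₁.list]
  intro τ₂ σ₂ hτ₂ ha₂ hq₂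
  have hc₂ : SweepContext n a l A σ₂ := by
    refine hc₁.congr ?_ ?_ ?_ ?_ ?_
    · rw [ha₂.ireg 0 rfl]; simp
    · rw [ha₂.ireg 5 rfl]; simp
    · rw [ha₂.rarr 1 rfl]; simp
    · rw [ha₂.rreg 2 rfl]; simp
    · rw [ha₂.iarr 3 rfl]; simp
  have hk₂ : σ₂.ireg 2 = k := by rw [ha₂.ireg 2 rfl]; simpa using hk₁
  have hAk : A (k - 1) < n := hA.lt _ (by omega)
  have hstart := hA.feasible_start (b := b) hl h1 hkn
  simp only [wp_seq, wp_iset, wp_rset, IExp.eval, RExp.eval, IExp.cost, RExp.cost,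
    Memory.setR_ireg, Memory.setR_iarr, Memory.setR_rarr, hk₂, hc₂.size, hc₂.list,
    hc₂.row _ hAk]
  refine ⟨by omega, ?_⟩
  refine (runs_sweepLoop (b := b) hW hkn hA hab (hc₂.congr ?_ ?_ ?_ ?_ ?_) ?_ ?_ ?_).wp ?_
  iterate 5 simp
  · simp
  -- The sweep starts with rank zero: nothing is counted yet, and the initial value `0` is a lower
  -- bound because distances are nonnegative.
  · refine ⟨∅, _, hq₂.congr (by simp) (by simp) (by simp), ?_, by simp, by simp, by simp, ?_, ?_⟩
    · simp [tail]
    · intro v hv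
      simpa using hb v (Finset.mem_range.1 (hA.tail_subset k hv))
    · simpa using hb
  · refine ⟨by simpa using hstart, by simp, fun i h h' h'' => by omega⟩
  intro τ₃ σ₃ hτ₃ ha₃ ⟨hr, hbest, hstart', hcross⟩
  have e2 : σ₃.rreg 2 = l := by
    rw [ha₃.rreg 2 rfl]
    simpa using hc₂.length
  have hr' := hr.isTailRank h1
  obtain ⟨T₃, Q₃, hq₃, _⟩ := hr
  have hent₃ := hq₃.entry_le
  -- The sweep has compared all crossings and the start; the comparison with the last value of `rreg
  -- 3`, the candidate above the second endpoint, is all that remains.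
  have hlow : ∀ t y, Feasible n k a b l t y → y ≤ σ₃.rreg 6 → y ≤ σ₃.rreg 3 →
      IsLowestFeasible n k a b l t y := by
    intro t y h h' h''
    refine ⟨h, fun t' y' hf => hA.le_of_feasible h1 hkn hba (h'.trans hstart') ⟨_, hr', h''⟩ ?_ hf⟩
    intro i h0 hi
    obtain ⟨β, hβ, hle⟩ := hcross i (Nat.zero_le _) h0 hi
    exact ⟨β, hβ, fun g => h'.trans (hle g)⟩
  have htime : 100 * (n + 1) + (n + 1) * (120 * (Nat.log 2 n + 3)) +
      (n + 1) * (260 * (Nat.log 2 n + 3)) + 100 ≤ (n + 2) * (600 * (Nat.log 2 n + 3)) := by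
    nlinarith
  simp only [tryEnd, wp_ite, wp_seq, wp_rset, wp_skip, BExp.Holds, RExp.eval, BExp.cost,
    RExp.cost, Memory.setR_iarr, Memory.setR_rreg]
  refine ⟨fun hlt => ⟨by omega, hent₃, ?_⟩, fun hge => ⟨by omega, hent₃, ?_⟩⟩
  · simpa [e2] using hlow _ _ (hA.feasible_end hl hr') hlt.le le_rfl
  · exact hlow _ _ hbest le_rfl (not_lt.1 hge)

end

/-! # The whole algorithm -/

/-- Store the lowest point `(rreg 5, rreg 6)` of the edge `ireg 4` and update the best edge. -/
def recordEdge : Program :=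
  .seq (.rput 2 (.reg 4) (.reg 5)) <| .seq (.rput 3 (.reg 4) (.reg 6)) <|
  .ite (.conj (.ilt (.lit 0) (.reg 4)) (.neg (.rlt (.reg 6) (.reg 1)))) .skip <|
    .seq (.iset 3 (.reg 4)) <| .seq (.rset 0 (.reg 5)) (.rset 1 (.reg 6))

/-- Process the edge `ireg 4`. -/
def processEdge : Program :=
  .seq (.iset 5 (.arr 0 (.reg 4))) <| .seq (.iset 6 (.arr 1 (.reg 4))) <|
  .seq (.rset 2 (.arr 0 (.reg 4))) <| .seq sortVertices <| .seq sweepEdge <|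
  .seq recordEdge <| .iset 4 (.add (.reg 4) (.lit 1))

/-- The algorithm. -/
def centerProgram : Program :=
  .seq (.iset 4 (.lit 0)) (.loop (.ilt (.reg 4) (.reg 1)) processEdge)

/-- The memory holds the problem: `r e`, `s e`, `len e` are the endpoints and the length of the edge
number `e`, and `D` is the distance matrix. -/
structure HoldsProblem (n m k : ℕ) (r s : ℕ → ℕ) (len : ℕ → ℝ) (D : ℕ → ℕ → ℝ)
    (σ : Memory) : Prop where
  size : σ.ireg 0 = n
  numEdges : σ.ireg 1 = m
  level : σ.ireg 2 = k
  fst : ∀ e < m, σ.iarr 0 e = r e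
  snd : ∀ e < m, σ.iarr 1 e = s e
  length : ∀ e < m, σ.rarr 0 e = len e
  dist : ∀ u < n, ∀ v < n, σ.rarr 1 (u * n + v) = D u v

theorem HoldsProblem.congr {n m k : ℕ} {r s : ℕ → ℕ} {len : ℕ → ℝ} {D : ℕ → ℕ → ℝ}
    {σ σ' : Memory} (h : HoldsProblem n m k r s len D σ) (h0 : σ'.ireg 0 = σ.ireg 0)
    (h1 : σ'.ireg 1 = σ.ireg 1) (h2 : σ'.ireg 2 = σ.ireg 2) (h3 : σ'.iarr 0 = σ.iarr 0)
    (h4 : σ'.iarr 1 = σ.iarr 1) (h5 : σ'.rarr 0 = σ.rarr 0) (h6 : σ'.rarr 1 = σ.rarr 1) :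
    HoldsProblem n m k r s len D σ' :=
  ⟨h0 ▸ h.size, h1 ▸ h.numEdges, h2 ▸ h.level, h3 ▸ h.fst, h4 ▸ h.snd, h5 ▸ h.length,
    h6 ▸ h.dist⟩

/-- The lowest points of the first `e` edges are stored, and the best of them is known. -/
def Processed (n k : ℕ) (r s : ℕ → ℕ) (len : ℕ → ℝ) (D : ℕ → ℕ → ℝ) (e : ℕ) (σ : Memory) : Prop :=
  (∀ i < e, IsLowestFeasible n k (D (r i)) (D (s i)) (len i) (σ.rarr 2 i) (σ.rarr 3 i)) ∧
    (0 < e → σ.ireg 3 < e ∧ σ.rreg 0 = σ.rarr 2 (σ.ireg 3) ∧ σ.rreg 1 = σ.rarr 3 (σ.ireg 3) ∧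
      ∀ i < e, σ.rreg 1 ≤ σ.rarr 3 i)

section

variable {W n m k : ℕ} {σ : Memory} {r s : ℕ → ℕ} {len : ℕ → ℝ} {D : ℕ → ℕ → ℝ}

/-- Edge `0` is recorded without comparison, since the initial content of `rreg 1` is not the height
of any point found. -/
theorem runs_recordEdge {e : ℕ} (he : σ.ireg 4 = e) (heW : e ≤ W)
    (h : Processed n k r s len D e σ)
    (hlow : IsLowestFeasible n k (D (r e)) (D (s e)) (len e) (σ.rreg 5) (σ.rreg 6)) :
    Runs W recordEdge σ 30 (Processed n k r s len D (e + 1)) := by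
  obtain ⟨h1, h2⟩ := h
  have hall : ∀ σ' : Memory, σ'.rarr 2 = Function.update (σ.rarr 2) e (σ.rreg 5) →
      σ'.rarr 3 = Function.update (σ.rarr 3) e (σ.rreg 6) →
      ∀ i < e + 1, IsLowestFeasible n k (D (r i)) (D (s i)) (len i) (σ'.rarr 2 i)
        (σ'.rarr 3 i) := by
    intro σ' g2 g3 i hi
    rw [g2, g3]
    rcases Nat.lt_succ_iff_lt_or_eq.1 hi with hi | rfl
    · rw [Function.update_of_ne (by omega), Function.update_of_ne (by omega)]
      exact h1 i hi
    · rwa [Function.update_self, Function.update_self]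
  simp only [Runs, recordEdge, wp_seq, wp_rput, wp_ite, wp_skip, wp_iset, wp_rset, BExp.Holds,
    IExp.eval, RExp.eval, BExp.cost, IExp.cost, RExp.cost, he, Memory.putR_ireg, Memory.putR_rreg]
  refine ⟨heW, heW, fun ⟨h0, hle⟩ => ⟨by omega, hall _ (by simp) (by simp), fun _ => ?_⟩,
    fun hn => ⟨heW, by omega, hall _ (by simp) (by simp), fun _ => ?_⟩⟩
  · obtain ⟨g1, g2, g3, g4⟩ := h2 h0
    simp only [Memory.putR_ireg, Memory.putR_rreg, Memory.putR_rarr, Function.update_self,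
      Function.update_of_ne (show (2 : ℕ) ≠ 3 by decide),
      Function.update_of_ne (show (3 : ℕ) ≠ 2 by decide)]
    rw [Function.update_of_ne (by omega), Function.update_of_ne (by omega)]
    refine ⟨by omega, g2, g3, fun i hi => ?_⟩
    rcases Nat.lt_succ_iff_lt_or_eq.1 hi with hi | rfl
    · rw [Function.update_of_ne (by omega)]
      exact g4 i hi
    · rw [Function.update_self]
      exact not_lt.1 hle
  · simp only [Memory.setI_ireg, Memory.setI_rreg, Memory.setI_rarr, Memory.setR_ireg,
      Memory.setR_rreg, Memory.setR_rarr, Memory.putR_rreg, Memory.putR_rarr,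
      Function.update_self, Function.update_of_ne (show (0 : ℕ) ≠ 1 by decide),
      Function.update_of_ne (show (6 : ℕ) ≠ 0 by decide),
      Function.update_of_ne (show (2 : ℕ) ≠ 3 by decide),
      Function.update_of_ne (show (3 : ℕ) ≠ 2 by decide)]
    refine ⟨by omega, trivial, trivial, fun i hi => ?_⟩
    rcases Nat.lt_succ_iff_lt_or_eq.1 hi with hi | rfl
    · rw [Function.update_of_ne (by omega)]
      rcases Nat.eq_zero_or_pos e with rfl | h0
      · omega
      · obtain ⟨g1, g2, g3, g4⟩ := h2 h0
        have : σ.rreg 6 < σ.rreg 1 := by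
          by_contra hlt
          exact hn ⟨h0, hlt⟩
        exact this.le.trans (g4 i hi)
    · rw [Function.update_self]

theorem runs_processEdge (hW : 2 * n ≤ W) (hmW : m ≤ W) (h1 : 1 ≤ k) (hk : k ≤ n)
    (hp : HoldsProblem n m k r s len D σ) {e : ℕ} (he : σ.ireg 4 = e) (hem : e < m)
    (hr : r e < n) (hs : s e < n) (hlen : 0 ≤ len e)
    (hrs : ∀ v < n, D (r e) v ≤ D (s e) v + len e) (hsr : ∀ v < n, D (s e) v ≤ D (r e) v + len e)
    (hD : ∀ v < n, 0 ≤ D (s e) v) (hent : ∀ i, σ.iarr 2 i ≤ n)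
    (h : Processed n k r s len D e σ) :
    Runs W processEdge σ ((n + 2) * (950 * (Nat.log 2 n + 3))) fun σ' =>
      (∀ i, σ'.iarr 2 i ≤ n) ∧ σ'.ireg 4 = e + 1 ∧ Processed n k r s len D (e + 1) σ' := by
  simp only [Runs, processEdge, wp_seq (p := .iset _ _), wp_seq (p := .rset _ _), wp_iset,
    wp_rset, IExp.eval, RExp.eval, he, Memory.setI_ireg, Memory.setI_iarr, Memory.setI_rarr,
    hp.fst e hem, hp.snd e hem, hp.length e hem, Function.update_of_ne (show (4 : ℕ) ≠ 5 by decide),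
    Function.update_of_ne (show (4 : ℕ) ≠ 6 by decide)]
  refine ⟨by omega, by omega, ?_⟩
  generalize hσ₀ : ((σ.setI 5 (r e)).setI 6 (s e)).setR 2 (len e) = σ₀
  have e4 : σ₀.ireg 4 = e := by simp [← hσ₀, he]
  have e5 : σ₀.ireg 5 = r e := by simp [← hσ₀]
  have e6 : σ₀.ireg 6 = s e := by simp [← hσ₀]
  have f2 : σ₀.rreg 2 = len e := by simp [← hσ₀]
  have hp₀ : HoldsProblem n m k r s len D σ₀ := by
    subst hσ₀
    exact hp.congr (by simp) (by simp) (by simp) (by simp) (by simp) (by simp) (by simp)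
  have h₀ : Processed n k r s len D e σ₀ := by
    subst hσ₀
    simpa [Processed] using h
  have hent₀ : ∀ i, σ₀.iarr 2 i ≤ n := by simpa [← hσ₀] using hent
  rw [wp_seq]
  refine (runs_sortVertices (a := D (r e)) hW hp₀.size (by rwa [e5]) hent₀ (fun v hv => ?_)).wp ?_
  · rw [e5]; exact hp₀.dist _ hr v hv
  intro τ₁ σ₁ hτ₁ ha₁ ⟨hent₁, hA⟩
  have hp₁ := hp₀.congr (ha₁.ireg 0 rfl) (ha₁.ireg 1 rfl) (ha₁.ireg 2 rfl) (ha₁.iarr 0 rfl)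
    (ha₁.iarr 1 rfl) (ha₁.rarr 0 rfl) (ha₁.rarr 1 rfl)
  have e5' := (ha₁.ireg 5 rfl).trans e5
  have e6' := (ha₁.ireg 6 rfl).trans e6
  rw [wp_seq]
  refine (runs_sweepEdge (b := D (s e)) (l := len e) hW h1 hk hp₁.level hA hlen hrs hsr hD
    ⟨hp₁.size, fun v hv => ?_, (ha₁.rreg 2 rfl).trans f2, rfl⟩ (by rwa [e6']) hent₁
    fun v hv => ?_).wp ?_
  · rw [e5']; exact hp₁.dist _ hr v hv
  · rw [e6']; exact hp₁.dist _ hs v hv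
  intro τ₂ σ₂ hτ₂ ha₂ ⟨hent₂, hlow⟩
  have e4' : σ₂.ireg 4 = e := (ha₂.ireg 4 rfl).trans ((ha₁.ireg 4 rfl).trans e4)
  have h₂ : Processed n k r s len D e σ₂ := by
    rw [Processed, ha₂.rarr 2 rfl, ha₂.rarr 3 rfl, ha₂.rreg 0 rfl, ha₂.rreg 1 rfl, ha₂.ireg 3 rfl,
      ha₁.rarr 2 rfl, ha₁.rarr 3 rfl, ha₁.rreg 0 rfl, ha₁.rreg 1 rfl, ha₁.ireg 3 rfl]
    exact h₀
  rw [wp_seq]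
  refine (runs_recordEdge e4' (by omega) h₂ hlow).wp ?_
  intro τ₃ σ₃ hτ₃ ha₃ h₃
  have e4'' := (ha₃.ireg 4 rfl).trans e4'
  rw [wp_iset]
  simp only [IExp.eval, IExp.cost, RExp.cost, e4'', Memory.setI_iarr, Memory.setI_ireg,
    Function.update_self]
  refine ⟨by omega, ?_, ?_, trivial, ?_⟩
  · nlinarith
  · rw [ha₃.iarr 2 rfl]
    exact hent₂
  · simpa [Processed] using h₃

theorem runs_centerProgram (hW : 2 * n ≤ W) (hmW : m ≤ W) (h1 : 1 ≤ k) (hk : k ≤ n)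
    (hp : HoldsProblem n m k r s len D σ) (hr : ∀ e < m, r e < n) (hs : ∀ e < m, s e < n)
    (hlen : ∀ e < m, 0 ≤ len e) (hrs : ∀ e < m, ∀ v < n, D (r e) v ≤ D (s e) v + len e)
    (hsr : ∀ e < m, ∀ v < n, D (s e) v ≤ D (r e) v + len e)
    (hD : ∀ e < m, ∀ v < n, 0 ≤ D (s e) v) (hent : ∀ i, σ.iarr 2 i ≤ n) :
    Runs W centerProgram σ ((m + 2) * ((n + 2) * (960 * (Nat.log 2 n + 3))))
      (Processed n k r s len D m) := by
  rw [Runs, centerProgram, wp_seq, wp_iset]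
  refine ⟨by simp [IExp.eval], ?_⟩
  refine (Runs.loop_le (B := (n + 2) * (950 * (Nat.log 2 n + 3)))
    (D := (n + 2) * (960 * (Nat.log 2 n + 3))) (R := Processed n k r s len D m)
    (fun p σ' => σ'.ireg 4 + p = m ∧ (∀ i, σ'.iarr 2 i ≤ n) ∧
      Processed n k r s len D (σ'.ireg 4) σ') _ m ?_ ?_ ?_ ?_).wp ?_
  · refine ⟨by simp [IExp.eval], by simpa using hent, ?_⟩
    simp [Processed, IExp.eval]
  · intro p σ' ha ⟨g1, g2, g3⟩ hb
    have e1 := ha.ireg 1 rfl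
    simp [hp.numEdges] at e1
    have : σ'.ireg 4 = m := by
      have : m ≤ σ'.ireg 4 := by simpa [BExp.Holds, IExp.eval, e1] using hb
      omega
    rwa [this] at g3
  · intro p σ' ha ⟨g1, g2, g3⟩ hb
    have hp' : HoldsProblem n m k r s len D σ' := by
      refine hp.congr ?_ ?_ ?_ ?_ ?_ ?_ ?_
      · rw [ha.ireg 0 rfl]; simp
      · rw [ha.ireg 1 rfl]; simp
      · rw [ha.ireg 2 rfl]; simp
      · rw [ha.iarr 0 rfl]; simp
      · rw [ha.iarr 1 rfl]; simp
      · rw [ha.rarr 0 rfl]; simp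
      · rw [ha.rarr 1 rfl]; simp
    have hem : σ'.ireg 4 < m := by simpa [BExp.Holds, IExp.eval, hp'.numEdges] using hb
    cases p with
    | zero => omega
    | succ p =>
      refine ⟨p, rfl, ?_⟩
      refine (runs_processEdge hW hmW h1 hk hp' rfl hem (hr _ hem) (hs _ hem) (hlen _ hem)
        (hrs _ hem) (hsr _ hem) (hD _ hem) g2 g3).mono le_rfl fun σ'' _ ⟨g4, g5, g6⟩ => ?_
      rw [g5]
      exact ⟨by omega, g4, g6⟩
  · simp only [BExp.cost, IExp.cost]
    nlinarith
  · intro τ σ' hτ _ h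
    refine ⟨?_, h⟩
    simp only [IExp.cost]
    nlinarith

end

/-! # Distances and shortest path trees -/

section Distance

variable {V : Type*} {G : SimpleGraph V} {len : Sym2 V → ℝ}

theorem walkLength_cons {u v w : V} (h : G.Adj u v) (p : G.Walk v w) :
    walkLength len (.cons h p) = len s(u, v) + walkLength len p := by
  simp [walkLength]

theorem walkLength_nonneg (hlen : ∀ e ∈ G.edgeSet, 0 < len e) {u v : V} (p : G.Walk u v) :
    0 ≤ walkLength len p := by
  refine List.sum_nonneg fun x hx => ?_
  obtain ⟨e, he, rfl⟩ := List.mem_map.1 hx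
  exact (hlen e (p.edges_subset_edgeSet he)).le

/-- The infimum runs over paths only; shortcutting a walk to a path leaves a sublist of its edges,
and edge lengths are positive. -/
theorem vdist_le_walkLength (hlen : ∀ e ∈ G.edgeSet, 0 < len e) {u v : V} (p : G.Walk u v) :
    vdist G len u v ≤ walkLength len p := by
  classical
  have hb : BddBelow (Set.range fun p : G.Path u v => walkLength len p.1) :=
    ⟨0, by rintro _ ⟨p, rfl⟩; exact walkLength_nonneg hlen _⟩
  refine (ciInf_le hb p.toPath).trans ?_
  refine List.Sublist.sum_le_sum (p.edges_bypass_sublist_edges.map len) fun x hx => ?_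
  obtain ⟨e, he, rfl⟩ := List.mem_map.1 hx
  exact (hlen e (p.edges_subset_edgeSet he)).le

variable [Finite V]

theorem exists_walkLength_eq_vdist (hG : G.Connected) (len : Sym2 V → ℝ) (u v : V) :
    ∃ p : G.Walk u v, walkLength len p = vdist G len u v := by
  classical
  have := Fintype.ofFinite V
  have : Finite (G.Path u v) := inferInstance
  have : Nonempty (G.Path u v) := ⟨(hG.preconnected u v).some.toPath⟩
  obtain ⟨p, hp⟩ := exists_eq_ciInf_of_finite (f := fun p : G.Path u v => walkLength len p.1)
  exact ⟨p.1, hp⟩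

theorem vdist_nonneg (hG : G.Connected) (hlen : ∀ e ∈ G.edgeSet, 0 < len e) (u v : V) :
    0 ≤ vdist G len u v := by
  obtain ⟨p, hp⟩ := exists_walkLength_eq_vdist hG len u v
  exact hp ▸ walkLength_nonneg hlen p

theorem vdist_self (hG : G.Connected) (hlen : ∀ e ∈ G.edgeSet, 0 < len e) (u : V) :
    vdist G len u u = 0 :=
  le_antisymm ((vdist_le_walkLength hlen .nil).trans (by simp [walkLength]))
    (vdist_nonneg hG hlen u u)

theorem vdist_comm (hG : G.Connected) (hlen : ∀ e ∈ G.edgeSet, 0 < len e) (u v : V) :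
    vdist G len u v = vdist G len v u := by
  have key : ∀ u v, vdist G len u v ≤ vdist G len v u := by
    intro u v
    obtain ⟨p, hp⟩ := exists_walkLength_eq_vdist hG len v u
    rw [← hp]
    refine (vdist_le_walkLength hlen p.reverse).trans (le_of_eq ?_)
    simp [walkLength, List.sum_reverse]
  exact le_antisymm (key u v) (key v u)

theorem vdist_le_len_add (hG : G.Connected) (hlen : ∀ e ∈ G.edgeSet, 0 < len e) {u v : V}
    (h : G.Adj u v) (w : V) : vdist G len u w ≤ len s(u, v) + vdist G len v w := by
  obtain ⟨p, hp⟩ := exists_walkLength_eq_vdist hG len v w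
  rw [← hp, ← walkLength_cons h]
  exact vdist_le_walkLength hlen _

theorem vdist_triangle (hG : G.Connected) (hlen : ∀ e ∈ G.edgeSet, 0 < len e) (u v w : V) :
    vdist G len u w ≤ vdist G len u v + vdist G len v w := by
  obtain ⟨p, hp⟩ := exists_walkLength_eq_vdist hG len u v
  obtain ⟨q, hq⟩ := exists_walkLength_eq_vdist hG len v w
  rw [← hp, ← hq]
  refine (vdist_le_walkLength hlen (p.append q)).trans (le_of_eq ?_)
  simp [walkLength]

theorem vdist_anti {T : SimpleGraph V} (hT : T.Connected) (hTG : T ≤ G)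
    (hlen : ∀ e ∈ G.edgeSet, 0 < len e) (u v : V) : vdist G len u v ≤ vdist T len u v := by
  obtain ⟨p, hp⟩ := exists_walkLength_eq_vdist hT len u v
  rw [← hp]
  refine (vdist_le_walkLength hlen (p.mapLe hTG)).trans (le_of_eq ?_)
  simp [walkLength]

/-- The last vertex before `v` on a shortest path from `r` to `v`. -/
theorem exists_predecessor (hG : G.Connected) (hlen : ∀ e ∈ G.edgeSet, 0 < len e) {r v : V}
    (hv : v ≠ r) : ∃ u, G.Adj v u ∧ len s(v, u) + vdist G len r u = vdist G len r v := by
  obtain ⟨p, hp⟩ := exists_walkLength_eq_vdist hG len v r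
  cases p with
  | nil => exact absurd rfl hv
  | @cons _ u _ h q =>
    refine ⟨u, h, ?_⟩
    have h1 := vdist_le_walkLength hlen q
    have h2 := vdist_le_len_add hG hlen h r
    rw [walkLength_cons] at hp
    rw [vdist_comm hG hlen r u, vdist_comm hG hlen r v]
    linarith

end Distance

/-! ### Trees given by a parent function. -/

section Parent

variable {V : Type*}

/-- `par` is the parent function of the tree `T` with root `root`; the parent has smaller rank. -/
structure IsParent (T : SimpleGraph V) (root : V) (par : V → V) (rank : V → ℝ) : Prop where
  adj : ∀ u v, T.Adj u v ↔ (u ≠ root ∧ par u = v) ∨ (v ≠ root ∧ par v = u)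
  rank_lt : ∀ v, v ≠ root → rank (par v) < rank v

theorem rank_induction [Finite V] {P : V → Prop} (rank : V → ℝ)
    (h : ∀ v, (∀ u, rank u < rank v → P u) → P v) (v : V) : P v := by
  have hwf : WellFounded fun u v : V => rank u < rank v :=
    @Finite.wellFounded_of_trans_of_irrefl V _ _ ⟨fun _ _ _ => lt_trans⟩ ⟨fun _ => lt_irrefl _⟩
  exact hwf.induction v h

/-- Descending ranks lead every vertex to the root, so `T` is connected. Each edge joins some `v ≠
root` to its parent, so there are at most `Nat.card V - 1` edges. -/
theorem IsParent.isTree [Finite V] {T : SimpleGraph V} {root : V} {par : V → V} {rank : V → ℝ}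
    (h : IsParent T root par rank) : T.IsTree := by
  classical
  have hreach : ∀ v, T.Reachable root v := by
    refine rank_induction rank fun v ih => ?_
    by_cases hv : v = root
    · rw [hv]
    · exact (ih _ (h.rank_lt v hv)).trans
        (SimpleGraph.Adj.reachable ((h.adj _ _).2 (.inr ⟨hv, rfl⟩)))
  have hc : T.Connected := by
    rw [SimpleGraph.connected_iff]
    exact ⟨fun u v => (hreach u).symm.trans (hreach v), ⟨root⟩⟩
  rw [SimpleGraph.isTree_iff_connected_and_card]
  refine ⟨hc, le_antisymm ?_ hc.card_vert_le_card_edgeSet_add_one⟩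
  have hsub : T.edgeSet ⊆ (fun v => s(v, par v)) '' {v | v ≠ root} := by
    intro e he
    induction e using Sym2.ind with
    | _ u v =>
      rcases (h.adj u v).1 he with ⟨h1, h2⟩ | ⟨h1, h2⟩
      · exact ⟨u, h1, by simp [h2]⟩
      · exact ⟨v, h1, by simp [h2, Sym2.eq_swap]⟩
  have h1 := (Set.ncard_le_ncard hsub (Set.toFinite _)).trans
    (Set.ncard_image_le (Set.toFinite _))
  have h2 : ({v | v ≠ root} : Set V).ncard + 1 = Nat.card V := by
    have : ({v | v ≠ root} : Set V) = {root}ᶜ := rfl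
    rw [this, ← Set.ncard_add_ncard_compl {root}, Set.ncard_singleton, add_comm]
  rw [Nat.card_coe_set_eq]
  omega

/-- A set of vertices of a rooted tree that is closed under taking parents, where one child `s` of
the root may be exempt, spans a subtree. -/
theorem IsParent.isTree_induce [Finite V] {T : SimpleGraph V} {root : V} {par : V → V}
    {rank : V → ℝ} (h : IsParent T root par rank) {s : V} (hs : s = root ∨ par s = root)
    {S : Set V} (hne : S.Nonempty) (hS : ∀ v ∈ S, v ≠ root → v ≠ s → par v ∈ S) :
    ((⊤ : T.Subgraph).induce S).coe.IsTree := by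
  classical
  have hmin : ∀ v, v ≠ root → rank root < rank v := by
    refine rank_induction rank fun v ih hv => ?_
    have h1 := h.rank_lt v hv
    by_cases hp : par v = root
    · rwa [hp] at h1
    · exact (ih _ h1 hp).trans h1
  -- The vertex of least rank in `S` becomes the root of the subtree: the old root if `S` contains
  -- it, otherwise `s`.
  obtain ⟨ρ, hρ, hρmin⟩ := Set.exists_min_image S rank (Set.toFinite S) hne
  have hclosed : ∀ v ∈ S, v ≠ ρ → v ≠ root ∧ par v ∈ S := by
    intro v hv hvρ
    have hroot : root ∈ S → ρ = root := fun hr => by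
      by_contra hne
      exact (hmin ρ hne).not_ge (hρmin root hr)
    have hvr : v ≠ root := by
      rintro rfl
      exact hvρ (hroot hv).symm
    refine ⟨hvr, ?_⟩
    by_cases hvs : v = s
    · have hps : par s = root := hs.resolve_left fun h => hvr (hvs.trans h)
      by_cases hρr : ρ = root
      · rw [hvs, hps, ← hρr]; exact hρ
      · exact absurd (hρmin _ (hS ρ hρ hρr fun h => hvρ (hvs.trans h.symm)))
          (h.rank_lt ρ hρr).not_ge
    · exact hS v hv hvr hvs
  have hparρ : ρ ≠ root → par ρ ∉ S := fun hne hmem =>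
    (h.rank_lt ρ hne).not_ge (hρmin _ hmem)
  let H := (⊤ : T.Subgraph).induce S
  have hρH : ρ ∈ H.verts := hρ
  -- The default can occur only at `ρ`, where the parent function is irrelevant.
  let par' : H.verts → H.verts := fun v => if hv : par v.1 ∈ S then ⟨par v.1, hv⟩ else v
  have hpar' : ∀ v : H.verts, v.1 ≠ ρ → (par' v).1 = par v.1 := by
    intro v hv
    simp [par', (hclosed v.1 v.2 hv).2]
  have key : ∀ u v : H.verts, (u.1 ≠ root ∧ par u.1 = v.1) ↔
      (u ≠ ⟨ρ, hρH⟩ ∧ par' u = v) := by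
    intro u v
    have e₁ : u ≠ ⟨ρ, hρH⟩ ↔ u.1 ≠ ρ := not_congr Subtype.ext_iff
    rw [e₁, Subtype.ext_iff]
    constructor
    · rintro ⟨h1, h2⟩
      have hu : u.1 ≠ ρ := fun hu => hparρ (hu ▸ h1) (by rw [← hu, h2]; exact v.2)
      exact ⟨hu, by rw [hpar' u hu, h2]⟩
    · rintro ⟨h1, h2⟩
      exact ⟨(hclosed u.1 u.2 h1).1, by rw [← hpar' u h1, h2]⟩
  refine IsParent.isTree (root := ⟨ρ, hρH⟩) (par := par') (rank := fun v => rank v.1) ⟨?_, ?_⟩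
  · intro u v
    rw [← key, ← key, ← h.adj]
    have hu : u.1 ∈ S := u.2
    have hv : v.1 ∈ S := v.2
    simp [hu, hv]
  · intro v hv
    have hv' : v.1 ≠ ρ := fun h => hv (Subtype.ext h)
    rw [hpar' v hv']
    exact h.rank_lt _ (hclosed v.1 v.2 hv').1

/-- The tree with a given parent function. -/
def parentGraph (root : V) (par : V → V) : SimpleGraph V :=
  .fromRel fun u v => u ≠ root ∧ par u = v

theorem isParent_parentGraph {root : V} {par : V → V} {rank : V → ℝ}
    (h : ∀ v, v ≠ root → rank (par v) < rank v) :
    IsParent (parentGraph root par) root par rank where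
  adj u v := by
    rw [parentGraph, SimpleGraph.fromRel_adj, and_iff_right_iff_imp]
    rintro (⟨h1, h2⟩ | ⟨h1, h2⟩) rfl
    · exact (h2 ▸ h u h1).false
    · exact (h2 ▸ h u h1).false
  rank_lt := h

theorem parentGraph_le {G : SimpleGraph V} {root : V} {par : V → V}
    (h : ∀ v, v ≠ root → G.Adj v (par v)) : parentGraph root par ≤ G := by
  intro u v huv
  rw [parentGraph, SimpleGraph.fromRel_adj] at huv
  rcases huv.2 with ⟨h1, h2⟩ | ⟨h1, h2⟩
  · exact h2 ▸ h u h1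
  · exact (h2 ▸ h v h1).symm

end Parent

/-! ### Shortest path trees of points of edges. -/

section ShortestPathTree

variable {V : Type*} {G : SimpleGraph V} {len : Sym2 V → ℝ}

theorem chain_eq_left {r s v : V} {t : ℝ}
    (h : t + vdist G len r v ≤ len s(r, s) - t + vdist G len s v) :
    chain G len r s v t = t + vdist G len r v := min_eq_left h

theorem chain_eq_right {r s v : V} {t : ℝ}
    (h : len s(r, s) - t + vdist G len s v ≤ t + vdist G len r v) :
    chain G len r s v t = len s(r, s) - t + vdist G len s v := min_eq_right h

/-- A point may be given with the endpoints of its edge in the order opposite to that of the edge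
list. -/
theorem chain_swap (G : SimpleGraph V) (len : Sym2 V → ℝ) (r s v : V) (t : ℝ) :
    chain G len s r v t = chain G len r s v (len s(r, s) - t) := by
  rw [chain, chain, min_comm, Sym2.eq_swap, sub_sub_cancel]

variable [Finite V]

theorem vdist_parentGraph_le (hlen : ∀ e ∈ G.edgeSet, 0 < len e) {root : V} {par : V → V}
    (hle : parentGraph root par ≤ G) (hT : (parentGraph root par).Connected) (q : V) {v : V}
    (hadj : (parentGraph root par).Adj v (par v)) :
    vdist (parentGraph root par) len q v ≤
      len s(v, par v) + vdist (parentGraph root par) len q (par v) := by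
  have hlen' : ∀ e ∈ (parentGraph root par).edgeSet, 0 < len e := fun e he =>
    hlen e (SimpleGraph.edgeSet_mono hle he)
  rw [vdist_comm hT hlen' q v, vdist_comm hT hlen' q (par v)]
  exact vdist_le_len_add hT hlen' hadj q

/-- A shortest path tree of a vertex. -/
theorem exists_tree_of_vertex (hG : G.Connected) (hlen : ∀ e ∈ G.edgeSet, 0 < len e) (r : V) :
    ∃ (T : SimpleGraph V) (par : V → V), T ≤ G ∧ IsParent T r par (vdist G len r) ∧
      ∀ v, vdist T len r v = vdist G len r v := by
  choose! par hadj hpar using fun v (hv : v ≠ r) => exists_predecessor (len := len) hG hlen hv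
  have hpos : ∀ v, v ≠ r → 0 < len s(v, par v) := fun v hv => hlen _ (hadj v hv)
  have hP : IsParent (parentGraph r par) r par (vdist G len r) :=
    isParent_parentGraph fun v hv => by
      have := hpar v hv
      have := hpos v hv
      linarith
  have hle := parentGraph_le hadj
  have hT := hP.isTree.connected
  refine ⟨_, par, hle, hP, fun v => le_antisymm ?_ (vdist_anti hT hle hlen r v)⟩
  induction v using rank_induction (vdist G len r) with
  | h v ih =>
    by_cases hv : v = r
    · rw [hv, vdist_self hT fun e he => hlen e (SimpleGraph.edgeSet_mono hle he)]
      exact vdist_nonneg hG hlen _ _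
    · have h1 := vdist_parentGraph_le hlen hle hT r ((hP.adj _ _).2 (.inl ⟨hv, rfl⟩))
      have h2 := ih _ (hP.rank_lt v hv)
      have h3 := hpar v hv
      linarith

/-- A point has a shortest path tree with a parent function such that, up to one exempt child `s` of
the root, parents are closer to the point. -/
theorem exists_shortestPathTree (hG : G.Connected) (hlen : ∀ e ∈ G.edgeSet, 0 < len e)
    (x : Point G len) : ∃ (T : SimpleGraph V) (root s : V) (par : V → V) (rank : V → ℝ),
      IsShortestPathTree x T ∧ IsParent T root par rank ∧ (s = root ∨ par s = root) ∧
      ∀ v, v ≠ root → v ≠ s → x.dist (par v) < x.dist v := by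
  obtain ⟨r, s, hadj, t, ht0, htl⟩ := x
  have hrs := vdist_comm hG hlen r s
  -- If one endpoint is optimal for all vertices, the point hangs at that endpoint and a shortest
  -- path tree of it will do. Otherwise each endpoint is strictly better for some vertex, and the
  -- tree must contain the edge `rs`.
  by_cases hr : ∀ v, t + vdist G len r v ≤ len s(r, s) - t + vdist G len s v
  · obtain ⟨T, par, hle, hP, hT⟩ := exists_tree_of_vertex hG hlen r
    refine ⟨T, r, r, par, _, ⟨hle, hP.isTree, .inr (.inl fun v => ?_)⟩, hP, .inl rfl,
      fun v hv _ => ?_⟩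
    · rw [hT]; exact (chain_eq_left (hr v)).symm
    · simp only [Point.dist, chain_eq_left (hr _)]
      exact add_lt_add_right (hP.rank_lt v hv) t
  by_cases hs : ∀ v, len s(r, s) - t + vdist G len s v ≤ t + vdist G len r v
  · obtain ⟨T, par, hle, hP, hT⟩ := exists_tree_of_vertex hG hlen s
    refine ⟨T, s, s, par, _, ⟨hle, hP.isTree, .inr (.inr fun v => ?_)⟩, hP, .inl rfl,
      fun v hv _ => ?_⟩
    · rw [hT]; exact (chain_eq_right (hs v)).symm
    · simp only [Point.dist, chain_eq_right (hs _)]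
      exact add_lt_add_right (hP.rank_lt v hv) _
  push Not at hr hs
  obtain ⟨v₁, hv₁⟩ := hr
  obtain ⟨v₂, hv₂⟩ := hs
  have hrr := vdist_self hG hlen r
  have hss := vdist_self hG hlen s
  have h₁ : len s(r, s) - t < t + vdist G len r s := by
    have := vdist_triangle hG hlen r s v₁
    linarith
  have h₂ : t < len s(r, s) - t + vdist G len s r := by
    have := vdist_triangle hG hlen s r v₂
    linarith
  choose! pr hpr hpr' using fun v (hv : v ≠ r) => exists_predecessor (len := len) hG hlen hv
  choose! ps hps hps' using fun v (hv : v ≠ s) => exists_predecessor (len := len) hG hlen hv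
  classical
  -- The vertices are split by the endpoint through which they are reached, with ties going to `r`.
  -- Predecessors on shortest paths stay on the same side, because the distance to the other
  -- endpoint changes by at most the length of the edge walked.
  let left : V → Prop := fun v => t + vdist G len r v ≤ len s(r, s) - t + vdist G len s v
  have hlr : left r := by simp only [left, hrr]; linarith
  have hls : ¬ left s := by simp only [left, hss]; linarith
  let par : V → V := fun v => if v = s then r else if left v then pr v else ps v
  have hpars : par s = r := by simp [par]
  have hparl : ∀ v, v ≠ s → left v → par v = pr v := fun v h h' => by simp [par, h, h']
  have hparr : ∀ v, v ≠ s → ¬ left v → par v = ps v := fun v h h' => by simp [par, h, h']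
  have hstepl : ∀ v, v ≠ r → left v → left (pr v) := by
    intro v hv hl
    have h1 := hpr' v hv
    have h2 := vdist_le_len_add hG hlen (hpr v hv) s
    rw [vdist_comm hG hlen v s, vdist_comm hG hlen (pr v) s] at h2
    simp only [left] at hl ⊢
    linarith
  have hstepr : ∀ v, v ≠ s → ¬ left v → ¬ left (ps v) := by
    intro v hv hl
    have h1 := hps' v hv
    have h2 := vdist_le_len_add hG hlen (hps v hv) r
    rw [vdist_comm hG hlen v r, vdist_comm hG hlen (ps v) r] at h2
    simp only [left, not_le] at hl ⊢
    linarith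
  have hdist : ∀ v, v ≠ r → v ≠ s → chain G len r s (par v) t < chain G len r s v t := by
    intro v hvr hvs
    by_cases hl : left v
    · rw [hparl v hvs hl, chain_eq_left hl, chain_eq_left (hstepl v hvr hl), ← hpr' v hvr]
      have := hlen s(v, pr v) (hpr v hvr)
      linarith
    · rw [hparr v hvs hl, chain_eq_right (not_le.1 hl).le,
        chain_eq_right (not_le.1 (hstepr v hvs hl)).le, ← hps' v hvs]
      have := hlen s(v, ps v) (hps v hvs)
      linarith
  have hchain : ∀ v, 0 ≤ chain G len r s v t := fun v =>
    le_min (add_nonneg ht0 (vdist_nonneg hG hlen _ _))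
      (add_nonneg (by linarith) (vdist_nonneg hG hlen _ _))
  have hadjpar : ∀ v, v ≠ r → G.Adj v (par v) := by
    intro v hvr
    by_cases hvs : v = s
    · rw [hvs, hpars]; exact hadj.symm
    · by_cases hl : left v
      · rw [hparl v hvs hl]; exact hpr v hvr
      · rw [hparr v hvs hl]; exact hps v hvs
  -- The root gets rank `-1` because `r` may be farther from the point than its child `s`; all
  -- distances are nonnegative.
  have hP : IsParent (parentGraph r par) r par
      fun v => if v = r then -1 else chain G len r s v t := by
    refine isParent_parentGraph fun v hv => ?_
    rw [if_neg hv]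
    split_ifs with hp
    · linarith [hchain v]
    · exact hdist v hv fun hvs => hp (hvs ▸ hpars)
  have hle := parentGraph_le hadjpar
  have hT := hP.isTree.connected
  have hlen' : ∀ e ∈ (parentGraph r par).edgeSet, 0 < len e := fun e he =>
    hlen e (SimpleGraph.edgeSet_mono hle he)
  refine ⟨_, r, s, par, _, ⟨hle, hP.isTree, .inl ⟨?_, fun v => le_antisymm ?_ ?_⟩⟩, hP,
    .inr hpars, hdist⟩
  · exact (hP.adj _ _).2 (.inr ⟨hadj.ne', hpars⟩)
  · have key : (left v → vdist (parentGraph r par) len r v ≤ vdist G len r v) ∧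
        (¬ left v → vdist (parentGraph r par) len s v ≤ vdist G len s v) := by
      induction v using rank_induction fun v => chain G len r s v t with
      | h v ih =>
        refine ⟨fun hl => ?_, fun hl => ?_⟩
        · by_cases hvr : v = r
          · rw [hvr, vdist_self hT hlen', hrr]
          · have hvs : v ≠ s := fun h => hls (h ▸ hl)
            have h1 := vdist_parentGraph_le hlen hle hT r ((hP.adj _ _).2 (.inl ⟨hvr, rfl⟩))
            have h2 := (ih _ (hdist v hvr hvs)).1
            rw [hparl v hvs hl] at h1 h2
            have h3 := h2 (hstepl v hvr hl)
            have h4 := hpr' v hvr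
            linarith
        · by_cases hvs : v = s
          · rw [hvs, vdist_self hT hlen', hss]
          · have hvr : v ≠ r := fun h => hl (h ▸ hlr)
            have h1 := vdist_parentGraph_le hlen hle hT s ((hP.adj _ _).2 (.inl ⟨hvr, rfl⟩))
            have h2 := (ih _ (hdist v hvr hvs)).2
            rw [hparr v hvs hl] at h1 h2
            have h3 := h2 (hstepr v hvs hl)
            have h4 := hps' v hvs
            linarith
    simp only [Point.dist]
    by_cases hl : left v
    · rw [chain_eq_left hl]
      exact min_le_of_left_le (add_le_add_right (key.1 hl) t)
    · rw [chain_eq_right (not_le.1 hl).le]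
      exact min_le_of_right_le (add_le_add_right (key.2 hl) _)
  · exact min_le_min (add_le_add_right (vdist_anti hT hle hlen r v) t)
      (add_le_add_right (vdist_anti hT hle hlen s v) _)

end ShortestPathTree

/-! # The objective function is the height of the `k`-th level -/

section Objective

variable {V : Type*} [Finite V]

/-- The `k`-th smallest value of a function exists and is one of its values. -/
theorem exists_isLeast_ncard_le (D : V → ℝ) {k : ℕ} (h1 : 1 ≤ k) (hk : k ≤ Nat.card V) :
    ∃ v, IsLeast {y | k ≤ {v | D v ≤ y}.ncard} (D v) := by
  -- Lowering `y` to the largest value that does not exceed it keeps the count, so only the finitely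
  -- many values of `D` compete.
  have hsub : ∀ y, k ≤ {v | D v ≤ y}.ncard → ∃ v, k ≤ {u | D u ≤ D v}.ncard ∧ D v ≤ y := by
    intro y hy
    have hne : {v | D v ≤ y}.Nonempty := by
      rw [← Set.ncard_pos]
      omega
    obtain ⟨v, hv, hmax⟩ := Set.exists_max_image _ D (Set.toFinite _) hne
    exact ⟨v, hy.trans (Set.ncard_le_ncard (fun u hu => hmax u hu)), hv⟩
  have hne : Nonempty V := by
    rw [← Finite.card_pos_iff]
    omega
  obtain ⟨v₀, -, hv₀⟩ := Set.exists_max_image Set.univ D (Set.toFinite _) Set.univ_nonempty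
  obtain ⟨v, hv, hmin⟩ := Set.exists_min_image {v | k ≤ {u | D u ≤ D v}.ncard} D (Set.toFinite _)
    ⟨v₀, by
      have : {u | D u ≤ D v₀} = Set.univ := Set.eq_univ_of_forall fun u => hv₀ u trivial
      rwa [Set.mem_ofPred_eq, this, Set.ncard_univ]⟩
  refine ⟨v, hv, fun y hy => ?_⟩
  obtain ⟨u, hu, huy⟩ := hsub y hy
  exact (hmin u hu).trans huy

variable {G : SimpleGraph V} {len : Sym2 V → ℝ}

/-- Fewer than `k` vertices are strictly closer than ρ and at least `k` are within ρ. Any `k`-set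
`S` in between is closed under parents, up to the exempt child, so it spans a subtree. -/
theorem isPhi_of_isLeast (hG : G.Connected) (hlen : ∀ e ∈ G.edgeSet, 0 < len e) {k : ℕ}
    (h1 : 1 ≤ k) (x : Point G len) {ρ : ℝ} (h : IsLeast {y | k ≤ {v | x.dist v ≤ y}.ncard} ρ) :
    IsPhi (fun _ => 1) k x ρ := by
  refine ⟨?_, ?_⟩
  · have hlt : {v | x.dist v < ρ}.ncard < k := by
      by_contra! hge
      have hne : {v | x.dist v < ρ}.Nonempty := by
        rw [← Set.ncard_pos]
        omega
      obtain ⟨v, hv, hmax⟩ := Set.exists_max_image _ x.dist (Set.toFinite _) hne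
      have : k ≤ {u | x.dist u ≤ x.dist v}.ncard :=
        hge.trans (Set.ncard_le_ncard fun u hu => hmax u hu)
      exact (h.2 this).not_gt hv
    obtain ⟨S, hS1, hS2, hS3⟩ := Set.exists_subsuperset_card_eq
      (s := {v | x.dist v < ρ}) (t := {v | x.dist v ≤ ρ}) (fun v (hv : x.dist v < ρ) => hv.le)
      hlt.le h.1
    obtain ⟨T, root, s, par, rank, hT, hP, hs, hpar⟩ := exists_shortestPathTree hG hlen x
    refine ⟨T, hT, (⊤ : T.Subgraph).induce S, ?_, hS3, ?_, ?_⟩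
    · refine hP.isTree_induce hs ?_ fun v hv hvr hvs => hS1 ?_
      · rw [← Set.ncard_pos]
        omega
      · exact (hpar v hvr hvs).trans_le (hS2 hv)
    -- `S` has `k` vertices, too many to be all strictly closer than ρ, so the value ρ is attained.
    · by_contra hn
      have : S ⊆ {v | x.dist v < ρ} := fun v hv =>
        lt_of_le_of_ne (hS2 hv) fun (he : x.dist v = ρ) => hn ⟨v, hv, by simp [he]⟩
      have := Set.ncard_le_ncard this
      omega
    · rintro _ ⟨v, hv, rfl⟩
      simpa using hS2 hv
  · rintro μ ⟨T, -, H, -, hk, hμ⟩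
    refine h.2 ?_
    rw [Set.mem_ofPred_eq, ← hk]
    exact Set.ncard_le_ncard fun v hv => by simpa using hμ.2 ⟨v, hv, rfl⟩

/-- By minimality `y` is the `k`-th smallest chain value at `t`, so the point is on a chain and its
count is the least admissible one. The closure adds nothing lower, since a closed half-plane
contains the level. -/
theorem isLowestPoint_kLevel {r s : V} {k : ℕ} (h1 : 1 ≤ k) (hk : k ≤ Nat.card V) {t y : ℝ}
    (ht0 : 0 ≤ t) (htl : t ≤ len s(r, s)) (h : k ≤ numBelow G len r s t y)
    (hmin : ∀ t' y', 0 ≤ t' → t' ≤ len s(r, s) → k ≤ numBelow G len r s t' y' → y ≤ y') :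
    IsLowestPoint (kLevel G len r s k) (t, y) := by
  refine ⟨subset_closure ⟨ht0, htl, ?_, h, fun v hv => ?_⟩, ?_⟩
  · obtain ⟨v, hv, hv'⟩ := exists_isLeast_ncard_le (fun v => chain G len r s v t) h1 hk
    exact ⟨v, le_antisymm (hmin t _ ht0 htl hv) (hv' h)⟩
  · exact Set.ncard_le_ncard fun u hu => le_trans hu (hmin t _ ht0 htl hv)
  · have hclosed : IsClosed {p : ℝ × ℝ | y ≤ p.2} := isClosed_le continuous_const continuous_snd
    exact fun p hp => closure_minimal (fun q hq => hmin q.1 q.2 hq.1 hq.2.1 hq.2.2.2.1) hclosed hp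

end Objective

/-! # Correctness and running time -/

/-- A function on `Fin n` as a function of all natural numbers. -/
def natExtend {n : ℕ} {α : Type*} [Zero α] (f : Fin n → α) (i : ℕ) : α :=
  if h : i < n then f ⟨i, h⟩ else 0

theorem natExtend_apply {n : ℕ} {α : Type*} [Zero α] (f : Fin n → α) {i : ℕ} (h : i < n) :
    natExtend f i = f ⟨i, h⟩ := dif_pos h

theorem natExtend_coe {n : ℕ} {α : Type*} [Zero α] (f : Fin n → α) (i : Fin n) :
    natExtend f i = f i := dif_pos i.2

theorem card_filter_range_eq_ncard (n : ℕ) (P : ℕ → Prop) [DecidablePred P] :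
    ((Finset.range n).filter P).card = {v : Fin n | P v}.ncard := by
  have : (((Finset.range n).filter P : Finset ℕ) : Set ℕ) = Fin.val '' {v : Fin n | P v} := by
    ext i
    simp only [Finset.coe_filter, Finset.mem_range, Set.mem_ofPred_eq, Set.mem_image]
    exact ⟨fun h => ⟨⟨i, h.1⟩, h.2, rfl⟩, by rintro ⟨v, hv, rfl⟩; exact ⟨v.2, hv⟩⟩
  rw [← Set.ncard_coe_finset, this, Set.ncard_image_of_injective _ Fin.val_injective]

section

variable {n m k : ℕ} {G : SimpleGraph (Fin n)} {len : Sym2 (Fin n) → ℝ}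
  {E : Fin m → Fin n × Fin n}

theorem feasible_natExtend_iff {r s : Fin n} {t y : ℝ} :
    Feasible n k (natExtend (vdist G len r)) (natExtend (vdist G len s)) (len s(r, s)) t y ↔
      0 ≤ t ∧ t ≤ len s(r, s) ∧ k ≤ numBelow G len r s t y := by
  rw [Feasible, card_filter_range_eq_ncard]
  simp only [natExtend_coe]
  rfl

theorem IsEdgeList.adj (hE : IsEdgeList G E) (i : Fin m) : G.Adj (E i).1 (E i).2 :=
  (SimpleGraph.mem_edgeSet G).1 (hE.2 ▸ Set.mem_range_self i)

theorem IsEdgeList.exists_eq (hE : IsEdgeList G E) {r s : Fin n} (h : G.Adj r s) :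
    ∃ i, E i = (r, s) ∨ E i = (s, r) := by
  have : s(r, s) ∈ Set.range fun i => s((E i).1, (E i).2) := by
    rw [hE.2]; exact h
  obtain ⟨i, hi⟩ := this
  refine ⟨i, ?_⟩
  rcases Sym2.eq_iff.1 hi with ⟨h1, h2⟩ | ⟨h1, h2⟩
  · exact .inl (Prod.ext h1 h2)
  · exact .inr (Prod.ext h1 h2)

/-- The edge counter runs up to `m`, which must fit into a machine word. -/
theorem IsEdgeList.le_sq (hE : IsEdgeList G E) : m ≤ n ^ 2 := by
  have : Function.Injective E := fun i j h => hE.1 (by simp [h])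
  simpa [sq] using Fintype.card_le_of_injective E this

theorem IsEdgeList.pos (hE : IsEdgeList G E) (hn : 2 ≤ n) (hG : G.Connected) : 0 < m := by
  have : Nontrivial (Fin n) := Fin.nontrivial_iff_two_le.2 hn
  obtain ⟨v, hv⟩ := hG.preconnected.exists_adj_of_nontrivial ⟨0, by omega⟩
  obtain ⟨i, -⟩ := hE.exists_eq hv
  exact i.pos

/-- The distances from vertex number `u` to vertex number `v`. -/
noncomputable def natDist (G : SimpleGraph (Fin n)) (len : Sym2 (Fin n) → ℝ) (u : ℕ) : ℕ → ℝ :=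
  natExtend fun v => natExtend (fun u => vdist G len u v) u

theorem natDist_coe (u : Fin n) : natDist G len u = natExtend (vdist G len u) := by
  simp only [natDist, natExtend_coe]

theorem holdsProblem_inputMemory :
    HoldsProblem n m k (natExtend fun i => ((E i).1 : ℕ)) (natExtend fun i => ((E i).2 : ℕ))
      (natExtend fun i => len s((E i).1, (E i).2)) (natDist G len) (inputMemory G len E k) where
  size := by simp [inputMemory]
  numEdges := by simp [inputMemory]
  level := by simp [inputMemory]
  fst e he := by simp [inputMemory, natExtend, he]
  snd e he := by simp [inputMemory, natExtend, he]
  length e he := by simp [inputMemory, natExtend, he]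
  dist u hu v hv := by
    have h1 : u * n + v < n * n := by nlinarith
    have h2 : (u * n + v) / n = u := by
      rw [mul_comm, Nat.mul_add_div (by omega), Nat.div_eq_of_lt hv, add_zero]
    have h3 : (u * n + v) % n = v := by
      rw [mul_comm, Nat.mul_add_mod, Nat.mod_eq_of_lt hv]
    simp [inputMemory, natDist, natExtend, hu, hv, h1, h2, h3]

theorem holdsSolution_of_processed (hG : G.Connected) (hlen : ∀ e ∈ G.edgeSet, 0 < len e)
    (hE : IsEdgeList G E) (h1 : 1 ≤ k) (hk : k ≤ n) (hm : 0 < m) {σ : Memory}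
    (h : Processed n k (natExtend fun i => ((E i).1 : ℕ)) (natExtend fun i => ((E i).2 : ℕ))
      (natExtend fun i => len s((E i).1, (E i).2)) (natDist G len) m σ) :
    HoldsSolution G len E k σ := by
  obtain ⟨hlow, hbest⟩ := h
  obtain ⟨g1, g2, g3, g4⟩ := hbest hm
  have hk' : k ≤ Nat.card (Fin n) := by simpa using hk
  have hfeas : ∀ i : Fin m, (0 ≤ σ.rarr 2 i ∧ σ.rarr 2 i ≤ len s((E i).1, (E i).2) ∧
      k ≤ numBelow G len (E i).1 (E i).2 (σ.rarr 2 i) (σ.rarr 3 i)) ∧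
      ∀ t y, 0 ≤ t → t ≤ len s((E i).1, (E i).2) → k ≤ numBelow G len (E i).1 (E i).2 t y →
        σ.rarr 3 i ≤ y := by
    intro i
    obtain ⟨hf, hmin⟩ := hlow i i.2
    simp only [natExtend_coe, natDist_coe] at hf hmin
    exact ⟨feasible_natExtend_iff.1 hf,
      fun t y ht0 htl hty => hmin t y (feasible_natExtend_iff.2 ⟨ht0, htl, hty⟩)⟩
  refine ⟨fun i => ?_, ?_⟩
  · obtain ⟨⟨a1, a2, a3⟩, a4⟩ := hfeas i
    exact isLowestPoint_kLevel h1 hk' a1 a2 a3 a4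
  obtain ⟨⟨a1, a2, a3⟩, a4⟩ := hfeas ⟨σ.ireg 3, g1⟩
  simp only [← g2, ← g3] at a1 a2 a3 a4
  refine ⟨⟨σ.ireg 3, g1⟩, ⟨_, _, hE.adj _, σ.rreg 0, a1, a2⟩, rfl, rfl, rfl, rfl, ?_, fun z => ?_⟩
  · exact isPhi_of_isLeast hG hlen h1 _ ⟨a3, fun y hy => a4 _ y a1 a2 hy⟩
  · obtain ⟨v, hv⟩ := exists_isLeast_ncard_le z.dist h1 hk'
    refine ⟨_, isPhi_of_isLeast hG hlen h1 z hv, ?_⟩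
    obtain ⟨i, hi⟩ := hE.exists_eq z.adj
    refine (g4 i i.2).trans ?_
    obtain ⟨-, hmin⟩ := hfeas i
    rcases hi with hi | hi
    · rw [hi] at hmin
      exact hmin z.t _ z.t_nonneg z.t_le hv.1
    · rw [hi] at hmin
      simp only [Sym2.eq_swap (a := z.s)] at hmin
      -- The edge is listed in reverse, so the distance is measured from its other end.
      refine hmin (len s(z.r, z.s) - z.t) _ (sub_nonneg.2 z.t_le)
        (sub_le_self _ z.t_nonneg) ?_
      have hz := hv.1
      rw [Set.mem_ofPred_eq] at hz
      simpa only [numBelow, chain_swap G len z.r z.s, sub_sub_cancel, Point.dist] using hz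

end

/-- From `2 ^ Nat.log 2 n ≤ n` and `2 ≤ n`, the left side is at most `4 * Real.log n / Real.log 2`,
and `4 / Real.log 2 < 8`. -/
theorem natLog_add_three_le {n : ℕ} (hn : 2 ≤ n) :
    ((Nat.log 2 n + 3 : ℕ) : ℝ) ≤ 8 * Real.log n := by
  have h2 := Real.log_two_gt_d9
  have h3 : Real.log 2 ≤ Real.log n := Real.log_le_log two_pos (by exact_mod_cast hn)
  have h4 : (Nat.log 2 n : ℝ) * Real.log 2 ≤ Real.log n := by
    rw [← Real.log_pow]
    refine Real.log_le_log (by positivity) ?_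
    exact_mod_cast Nat.pow_log_le_self 2 (by omega)
  push_cast
  nlinarith [Nat.cast_nonneg (α := ℝ) (Nat.log 2 n)]

end OneCenter

theorem mainTheorem2 :
    ∃ (P : OneCenter.Program) (C : ℝ) (c : ℕ),
      ∀ (n m k : ℕ) (G : SimpleGraph (Fin n)) (len : Sym2 (Fin n) → ℝ)
        (E : Fin m → Fin n × Fin n),
        2 ≤ n → 1 ≤ k → k ≤ n → G.Connected → (∀ e ∈ G.edgeSet, 0 < len e) →
        OneCenter.IsEdgeList G E →
        ∃ (τ : ℕ) (σ : OneCenter.Memory),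
          OneCenter.Exec (n ^ c) P (OneCenter.inputMemory G len E k) τ σ ∧
          (τ : ℝ) ≤ C * (m * n * Real.log n) ∧
          OneCenter.HoldsSolution G len E k σ := by
  refine ⟨OneCenter.centerProgram, 100000, 2, ?_⟩
  intro n m k G len E hn h1 hk hG hlen hE
  have hm := hE.pos hn hG
  have hpos : ∀ i, 0 < len s((E i).1, (E i).2) := fun i => hlen _ (hE.adj i)
  have hrun := OneCenter.runs_centerProgram (W := n ^ 2) (by nlinarith) hE.le_sq h1 hk
    (OneCenter.holdsProblem_inputMemory (G := G) (len := len) (E := E) (k := k))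
    (fun e he => ?_) (fun e he => ?_) (fun e he => ?_) (fun e he v hv => ?_)
    (fun e he v hv => ?_) (fun e he v hv => ?_) (fun i => ?_)
  · obtain ⟨τ, σ, hexec, hτ, hσ⟩ := hrun
    refine ⟨τ, σ, hexec, ?_, OneCenter.holdsSolution_of_processed hG hlen hE h1 hk hm hσ⟩
    have hlog := OneCenter.natLog_add_three_le hn
    -- `5760 = 3 * 2 * 960`, from `m + 2 ≤ 3 * m` and `n + 2 ≤ 2 * n`. With the factor `8` of the
    -- logarithm this stays below the generous constant `100000`.
    have hτ' : τ ≤ 5760 * (m * n) * (Nat.log 2 n + 3) := by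
      rw [zero_add] at hτ
      refine hτ.trans ?_
      calc (m + 2) * ((n + 2) * (960 * (Nat.log 2 n + 3)))
          ≤ (3 * m) * ((2 * n) * (960 * (Nat.log 2 n + 3))) := by gcongr <;> omega
        _ = _ := by ring
    calc (τ : ℝ) ≤ ((5760 * (m * n) * (Nat.log 2 n + 3) : ℕ) : ℝ) := by exact_mod_cast hτ'
      _ = 5760 * (m * n) * ((Nat.log 2 n + 3 : ℕ) : ℝ) := by push_cast; ring
      _ ≤ 5760 * (m * n) * (8 * Real.log n) := by gcongr
      _ ≤ 100000 * (m * n * Real.log n) := by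
        have : 0 ≤ m * n * Real.log n := by positivity
        linarith
  · rw [OneCenter.natExtend_apply _ he]; exact Fin.is_lt _
  · rw [OneCenter.natExtend_apply _ he]; exact Fin.is_lt _
  · rw [OneCenter.natExtend_apply _ he]; exact (hpos _).le
  · rw [OneCenter.natExtend_apply _ he, OneCenter.natExtend_apply _ he,
      OneCenter.natExtend_apply _ he, OneCenter.natDist_coe, OneCenter.natDist_coe,
      OneCenter.natExtend_apply _ hv, OneCenter.natExtend_apply _ hv, add_comm]
    exact OneCenter.vdist_le_len_add hG hlen (hE.adj _) _
  · rw [OneCenter.natExtend_apply _ he, OneCenter.natExtend_apply _ he,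
      OneCenter.natExtend_apply _ he, OneCenter.natDist_coe, OneCenter.natDist_coe,
      OneCenter.natExtend_apply _ hv, OneCenter.natExtend_apply _ hv, add_comm, Sym2.eq_swap]
    exact OneCenter.vdist_le_len_add hG hlen (hE.adj _).symm _
  · rw [OneCenter.natExtend_apply _ he, OneCenter.natDist_coe, OneCenter.natExtend_apply _ hv]
    exact OneCenter.vdist_nonneg hG hlen _ _
  · simp [OneCenter.inputMemory]
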